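/- Fix $N\ge 1$. For $k,\ell\ge 0$ let $\mathcal P(k,\ell)$ be the set of partitions of a row of $k$ upper points and a row of $\ell$ lower points. Such a partition $p$ is crossing if, with the upper points ordered from left to right followed by the lower points from right to left, there are points $\kappa_1<\kappa_2<\kappa_3<\kappa_4$ with $\kappa_1\sim_p\kappa_3$, $\kappa_2\sim_p\kappa_4$ and $\kappa_1\not\sim_p\kappa_2$; let $\mathcal{NC}(k,\ell)$ be the set of non-crossing partitions and $\mathcal{CR}(k,\ell)$ the set of crossing ones. Let $T_p\in M_{N^\ell\times N^k}(\mathbb C)$ be the matrix whose entry at $(\mathbf i,\mathbf j)\in[N]^\ell\times[N]^k$ is $1$ if writing $\mathbf j$ on the upper points and $\mathbf i$ on the lower points (left to right) gives equal indices on points of the same block, and $0$ otherwise; write $\xi_p=T_p\in(\mathbb C^N)^{\otimes k}$ for $p\in\mathcal P(0,k)$. A Tannaka--Krein dual (at parameter $N$) is a collection of linear subspaces $\hom_{\mathcal C}(k,\ell)\subseteq M_{N^\ell\times N^k}(\mathbb C)$, $k,\ell\ge0$, that is closed under tensor products, composition (matrix multiplication) and adjoints, and contains the identity matrix $I_N\in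 M_{N\times N}(\mathbb C)$ and the row vector $(\delta_{ij})_{(i,j)\in[N]^2}\in\hom_{\mathcal C}(2,0)$. By abuse of notation let $\mathcal P$ and $\mathcal{NC}$ be the Tannaka--Krein duals $\hom_{\mathcal P}(k,\ell)=\operatorname{span}(T_p: p\in\mathcal P(k,\ell))$ of the permutation group $S_N$ and $\hom_{\mathcal{NC}}(k,\ell)=\operatorname{span}(T_p: p\in\mathcal{NC}(k,\ell))$ of the quantum permutation group $S_N^+$, and let $\langle\mathcal{NC},\xi\rangle$ be the smallest Tannaka--Krein dual that contains $\mathcal{NC}$ and $\xi$. The inclusion $S_N\le S_N^+$ is said to be maximal at easiness-moment-level $(m,k)$ if for every non-zero $\xi=\sum_{i=1}^m\alpha_i\xi_{p_i}$ with $\alpha_i\in\mathbb C$ and $p_i\in\mathcal{CR}(0,k)$, $\langle\mathcal{NC},\xi\rangle$ equals $\mathcal P$ or $\mathcal{NC}$. **Theorem C.** For generic $N\ge 6$, that is, for all but finitely many integers $N\geq 6$, the inclusion $S_N\le S_N^+$ is maximal at easiness-moment-level $(31,6)$; moreover, for these $N$, $\langle\mathcal{NC},\xi\rangle=\mathcal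 P$ for every non-zero linear combination $\xi$ of at most $31$ crossing-partition vectors $\xi_p$, $p\in\mathcal{CR}(0,6)$. In particular, $N=6$ is not one of the exceptions: all of this holds for $S_6<S_6^+$. -/

import Mathlib

noncomputable section

namespace TannakaKrein

/-- Matrices in `M_{N^l × N^k}(ℂ)`: rows are indexed by `[N]^l`, columns by `[N]^k`. -/
abbrev Mat (N k l : ℕ) : Type := Matrix (Fin l → Fin N) (Fin k → Fin N) ℂ

/-- The tensor (Kronecker) product of `S ∈ M_{N^l × N^k}(ℂ)` and `T ∈ M_{N^l' × N^k'}(ℂ)`, with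
`[N]^(k + k')` identified with `[N]^k × [N]^k'` by concatenation of words. -/
def tensor {N k l k' l' : ℕ} (S : Mat N k l) (T : Mat N k' l') : Mat N (k + k') (l + l') :=
  fun i j =>
    S (fun a => i (Fin.castAdd l' a)) (fun a => j (Fin.castAdd k' a)) *
      T (fun b => i (Fin.natAdd l b)) (fun b => j (Fin.natAdd k b))

/-- The cup, a row vector in `hom(2,0)` with entries `δ_{j₁ j₂}`. -/
def cup (N : ℕ) : Mat N 2 0 := fun _ j => if j 0 = j 1 then 1 else 0

/-- A collection of vector spaces `hom(k,l) ⊆ M_{N^l × N^k}(ℂ)`, `k, l ≥ 0`, ordered by inclusion.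
It carries the (pointwise) complete lattice structure. -/
abbrev Family (N : ℕ) : Type := (k l : ℕ) → Submodule ℂ (Mat N k l)

/-- The axioms of a Tannaka--Krein dual (of a quantum subgroup of `O_N^+`). -/
structure IsDual {N : ℕ} (C : Family N) : Prop where
  tensor_mem : ∀ {k l k' l' : ℕ} {S : Mat N k l} {T : Mat N k' l'},
    S ∈ C k l → T ∈ C k' l' → tensor S T ∈ C (k + k') (l + l')
  comp_mem : ∀ {k l r : ℕ} {S : Mat N l r} {T : Mat N k l},
    S ∈ C l r → T ∈ C k l → S * T ∈ C k r
  adjoint_mem : ∀ {k l : ℕ} {T : Mat N k l}, T ∈ C k l → T.conjTranspose ∈ C l k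
  id_mem : (1 : Mat N 1 1) ∈ C 1 1
  cup_mem : cup N ∈ C 2 0

/-- `⟨C, T⟩`: the intersection of all Tannaka--Krein duals that contain the family `C` and the
matrix `T`. It is the smallest one, see `generated_isLeast`. -/
def generated {N : ℕ} (C : Family N) {k l : ℕ} (T : Mat N k l) : Family N :=
  sInf {D : Family N | IsDual D ∧ C ≤ D ∧ T ∈ D k l}

theorem mem_generated {N : ℕ} {C : Family N} {k l : ℕ} {T : Mat N k l} {a b : ℕ}
    {S : Mat N a b} :
    S ∈ generated C T a b ↔ ∀ D : Family N, IsDual D → C ≤ D → T ∈ D k l → S ∈ D a b := by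
  simp only [generated, sInf_apply, iInf_apply, Submodule.mem_iInf, Subtype.forall,
    Set.mem_ofPred_eq, and_imp]

theorem generated_isLeast {N : ℕ} (C : Family N) {k l : ℕ} (T : Mat N k l) :
    IsLeast {D : Family N | IsDual D ∧ C ≤ D ∧ T ∈ D k l} (generated C T) := by
  refine ⟨⟨⟨?_, ?_, ?_, ?_, ?_⟩, ?_, ?_⟩, fun D hD => sInf_le hD⟩
  · intro _ _ _ _ _ _ hS hT
    rw [mem_generated] at *
    exact fun D h1 h2 h3 => h1.tensor_mem (hS D h1 h2 h3) (hT D h1 h2 h3)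
  · intro _ _ _ _ _ hS hT
    rw [mem_generated] at *
    exact fun D h1 h2 h3 => h1.comp_mem (hS D h1 h2 h3) (hT D h1 h2 h3)
  · intro _ _ _ hT
    rw [mem_generated] at *
    exact fun D h1 h2 h3 => h1.adjoint_mem (hT D h1 h2 h3)
  · exact mem_generated.2 fun D h1 _ _ => h1.id_mem
  · exact mem_generated.2 fun D h1 _ _ => h1.cup_mem
  · exact fun a b S hS => mem_generated.2 fun D _ h2 _ => h2 a b hS
  · exact mem_generated.2 fun D _ _ h3 => h3

/-- `P(k,l)`: partitions of `k` upper points (`Sum.inl`) and `l` lower points (`Sum.inr`), both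
numbered from left to right. A partition is given by its equivalence relation `∼_p`
("being in the same block"). -/
abbrev Partition (k l : ℕ) : Type := Setoid (Fin k ⊕ Fin l)

/-- The position of a point in the order used to detect crossings: first the upper points from
left to right, then the lower points from right to left. -/
def position {k l : ℕ} : Fin k ⊕ Fin l → ℕ :=
  Sum.elim (fun a => (a : ℕ)) (fun b => k + (Fin.rev b : ℕ))

/-- `p` is a crossing partition: there are points `κ₁ < κ₂ < κ₃ < κ₄` such that `κ₁ ∼ κ₃` and
`κ₂ ∼ κ₄` but not `κ₁ ∼ κ₂`. -/
def Partition.IsCrossing {k l : ℕ} (p : Partition k l) : Prop :=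
  ∃ x₁ x₂ x₃ x₄ : Fin k ⊕ Fin l,
    position x₁ < position x₂ ∧ position x₂ < position x₃ ∧ position x₃ < position x₄ ∧
      p x₁ x₃ ∧ p x₂ x₄ ∧ ¬ p x₁ x₂

open Classical in
/-- The matrix `T_p` with entries `δ_p(i, j)`, where the upper points carry the word `j` and the
lower points carry the word `i`. -/
def partMat (N : ℕ) {k l : ℕ} (p : Partition k l) : Mat N k l :=
  fun i j => if ∀ x y : Fin k ⊕ Fin l, p x y → Sum.elim j i x = Sum.elim j i y then 1 else 0

/-- The Tannaka--Krein dual `P` of `S_N` at parameter `N`: `hom_P(k,l)` is the span of all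
`T_p`, `p ∈ P(k,l)`. -/
def homP (N : ℕ) : Family N := fun k l =>
  Submodule.span ℂ {T | ∃ p : Partition k l, T = partMat N p}

/-- The Tannaka--Krein dual `NC` of `S_N^+` at parameter `N`: `hom_NC(k,l)` is the span of all
`T_p`, `p ∈ NC(k,l)`. -/
def homNC (N : ℕ) : Family N := fun k l =>
  Submodule.span ℂ {T | ∃ p : Partition k l, ¬ p.IsCrossing ∧ T = partMat N p}

/-- The linear combination `∑ αᵢ ξ_{pᵢ}` of partition vectors in `hom_P(0,k)`. -/
def combination (N : ℕ) {m k : ℕ} (α : Fin m → ℂ) (p : Fin m → Partition 0 k) : Mat N 0 k :=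
  ∑ i, α i • partMat N (p i)

/-- The inclusion `S_N ≤ S_N^+` is maximal at easiness-moment-level `(m,k)`. -/
def IsMaximalAtEasinessMomentLevel (N m k : ℕ) : Prop :=
  ∀ (α : Fin m → ℂ) (p : Fin m → Partition 0 k), (∀ i, (p i).IsCrossing) →
    combination N α p ≠ 0 →
      generated (homNC N) (combination N α p) = homP N ∨
        generated (homNC N) (combination N α p) = homNC N

end TannakaKrein

end

/-! Let D be a dual containing NC, and let X be the vector of the crossing of two pairs on four
points. If X lies in D, then bending two of its legs gives the flip of two strands. With rotations,
the flip realises every permutation of the points. Every partition is a permuted noncrossing one, so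
D contains P (`IsDual.homP_le`).

It remains to show that if X is not in D, then a combination of at most 31 crossing vectors on six
points that lies in D has only zero coefficients (`eq_zero_of_card_le`). Duals are stable under
rotating the points, merging two neighbours and summing out a point. These operations send partition
vectors to scalar multiples of partition vectors, and noncrossing images lie in D. A relation modulo
D on some points therefore yields relations modulo D on one point fewer.

From four points to five, this shows that the ten crossing vectors are linearly independent modulo D
(`isSeparated_five`). From five points to six, it gives a linear system for the 71 coefficients
(`crossingRelations`). Each solution is determined by five numbers (`CrossingRelations.solution`),
and unless all five vanish, at least 32 coefficients are nonzero (`le_solutionCount`). The last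
bound holds because the coefficients are linear forms that cannot vanish in large groups at once. -/

namespace TannakaKrein

variable {N : ℕ}

/-! ### Bending, rotating, capping and merging inside a dual -/

theorem tensor_one_one (n : ℕ) :
    tensor (1 : Mat N n n) (1 : Mat N 1 1) = (1 : Mat N (n + 1) (n + 1)) := by
  ext i j
  have h : i = j ↔ (fun a => i (Fin.castAdd 1 a)) = (fun a => j (Fin.castAdd 1 a)) ∧
      (fun b => i (Fin.natAdd n b)) = (fun b => j (Fin.natAdd n b)) := by
    constructor
    · rintro rfl; exact ⟨rfl, rfl⟩
    · rintro ⟨h1, h2⟩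
      funext x
      induction x using Fin.addCases with
      | left a => exact congrFun h1 a
      | right b => exact congrFun h2 b
  simp only [tensor, Matrix.one_apply, ← ite_and, mul_ite, mul_one, mul_zero]
  simp only [h, and_comm]

theorem tensor_one_append {n a b : ℕ} (S : Mat N a b) (i : Fin (n + b) → Fin N)
    (u : Fin n → Fin N) (s : Fin a → Fin N) :
    tensor (1 : Mat N n n) S i (Fin.append u s) =
      (1 : Mat N n n) (fun x => i (Fin.castAdd b x)) u * S (fun x => i (Fin.natAdd n x)) s := by
  have h1 : (fun x => Fin.append u s (Fin.castAdd a x)) = u := funext (Fin.append_left u s)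
  have h2 : (fun x => Fin.append u s (Fin.natAdd n x)) = s := funext (Fin.append_right u s)
  rw [tensor, h1, h2]

/-- The identity factor fixes the first `n` letters, so only the sum over the last `a` letters
survives. Operations on the last points are computed with this formula. -/
theorem tensor_one_mul_apply {n a b k : ℕ} (S : Mat N a b) (T : Mat N k (n + a))
    (i : Fin (n + b) → Fin N) (j : Fin k → Fin N) :
    (tensor (1 : Mat N n n) S * T) i j =
      ∑ s : Fin a → Fin N, S (fun x => i (Fin.natAdd n x)) s *
        T (Fin.append (fun x => i (Fin.castAdd b x)) s) j := by
  have h : ∀ u s, Fin.appendEquiv (α := Fin N) n a (u, s) = Fin.append u s := fun _ _ => rfl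
  rw [Matrix.mul_apply, ← (Fin.appendEquiv n a).sum_comp, Fintype.sum_prod_type,
    Finset.sum_eq_single (fun x => i (Fin.castAdd b x))]
  · refine Finset.sum_congr rfl fun s _ => ?_
    rw [h, tensor_one_append, Matrix.one_apply_eq, one_mul]
  · intro u _ hu
    refine Finset.sum_eq_zero fun s _ => ?_
    rw [h, tensor_one_append, Matrix.one_apply_ne (Ne.symm hu), zero_mul, zero_mul]
  · simp

/-- The partition with a single block is noncrossing. -/
theorem not_isCrossing_top (k l : ℕ) : ¬ Partition.IsCrossing (⊤ : Partition k l) := by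
  rintro ⟨_, _, _, _, _, _, _, _, _, h⟩
  exact h trivial

namespace IsDual

variable {D : Family N} (hD : IsDual D) (hNC : homNC N ≤ D)
include hD

theorem cup_adjoint_mem : (cup N).conjTranspose ∈ D 0 2 := hD.adjoint_mem hD.cup_mem

omit hD in
theorem cast_mem {k l l' : ℕ} (h : l = l') {T : Mat N k l} (hT : T ∈ D k l) :
    (fun i j => T (fun x => i (Fin.cast h x)) j : Mat N k l') ∈ D k l' := by
  subst h; exact hT

omit hD in
theorem partMat_mem (hNC : homNC N ≤ D) {k l : ℕ} {p : Partition k l} (hp : ¬ p.IsCrossing) :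
    partMat N p ∈ D k l :=
  hNC k l (Submodule.subset_span ⟨p, hp, rfl⟩)

include hNC in
theorem one_mem (n : ℕ) : (1 : Mat N n n) ∈ D n n := by
  induction n with
  -- The axioms supply the identity on one point only. On zero points it is the matrix of the
  -- one-block partition, which comes from NC.
  | zero =>
    convert partMat_mem hNC (not_isCrossing_top 0 0) using 1
    ext i j
    rw [Subsingleton.elim i j]
    simp [partMat]
  | succ n ih =>
    rw [← tensor_one_one]
    exact hD.tensor_mem ih hD.id_mem

include hNC in
/-- The last lower point may be moved to the upper row. -/
theorem bend_mem {k l : ℕ} {T : Mat N k (l + 1)} (hT : T ∈ D k (l + 1)) :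
    (fun i j => T (Fin.snoc i (j (Fin.last k))) (fun x => j x.castSucc) : Mat N (k + 1) l) ∈
      D (k + 1) l := by
  have h1 : (tensor (k := k) (l := l + 1) (k' := 1) (l' := 1) T 1 : Mat N (k + 1) (l + 2)) ∈ D (k + 1) (l + 2) :=
    hD.tensor_mem hT hD.id_mem
  have h2 : (tensor (1 : Mat N l l) (cup N) : Mat N (l + 2) l) ∈ D (l + 2) l :=
    hD.tensor_mem (one_mem hD hNC l) hD.cup_mem
  refine Eq.subst (motive := (· ∈ D (k + 1) l)) ?_ (hD.comp_mem h2 h1)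
  ext i j
  refine (tensor_one_mul_apply (n := l) (a := 2) (b := 0) (cup N)
    (tensor (k := k) (l := l + 1) (k' := 1) (l' := 1) T 1) i j).trans ?_
  -- The cup makes the two summed letters equal, and the extra identity strand makes them equal to
  -- the last upper letter.
  rw [Finset.sum_eq_single (fun _ => j (Fin.last k))]
  · simp only [cup, if_true, one_mul, tensor]
    have h1 : (fun b : Fin 1 => Fin.append (fun x => i (Fin.castAdd 0 x))
        (fun _ : Fin 2 => j (Fin.last k)) (Fin.natAdd (l + 1) b)) =
        fun b : Fin 1 => j (Fin.natAdd k b) := by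
      funext b
      have : (Fin.natAdd (l + 1) b : Fin (l + 1 + 1)) = Fin.natAdd l (1 : Fin 2) := by
        ext; simp
      rw [this]
      erw [Fin.append_right]
      congr 1
      ext; simp
    rw [h1, Matrix.one_apply_eq, mul_one]
    congr 1
    funext x
    induction x using Fin.lastCases with
    | last =>
      rw [Fin.snoc_last]
      have : (Fin.castAdd 1 (Fin.last l) : Fin (l + 1 + 1)) = Fin.natAdd l (0 : Fin 2) := by
        ext; simp
      rw [this]
      erw [Fin.append_right]
    | cast x =>
      rw [Fin.snoc_castSucc]
      have : (Fin.castAdd 1 (Fin.castSucc x) : Fin (l + 1 + 1)) = Fin.castAdd 2 x := by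
        ext; simp
      rw [this]
      erw [Fin.append_left]
      rfl
  · intro s _ hs
    by_cases h : s 0 = s 1
    · have h1 : (fun b : Fin 1 => Fin.append (fun x => i (Fin.castAdd 0 x))
          s (Fin.natAdd (l + 1) b)) ≠ fun b : Fin 1 => j (Fin.natAdd k b) := by
        intro h'
        apply hs
        have h2 := congrFun h' 0
        have : (Fin.natAdd (l + 1) (0 : Fin 1) : Fin (l + 1 + 1)) = Fin.natAdd l (1 : Fin 2) := by
          ext; simp
        rw [this] at h2
        erw [Fin.append_right] at h2
        have h3 : (Fin.natAdd k (0 : Fin 1)) = Fin.last k := by ext; simp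
        rw [h3] at h2
        funext b
        fin_cases b
        · exact h.trans h2
        · exact h2
      simp only [tensor]
      rw [Matrix.one_apply_ne h1]
      simp
    · simp [cup, h]
  · simp

include hNC in
-- The last point is bent up on the right, and the adjoint of the cup brings it down again on the
-- left.
theorem rotate_mem {n : ℕ} {f : Mat N 0 (n + 1)} (hf : f ∈ D 0 (n + 1)) :
    (fun i j => f (Fin.snoc (fun x : Fin n => i x.succ) (i 0)) j : Mat N 0 (n + 1)) ∈
      D 0 (n + 1) := by
  have h := cast_mem (Nat.add_comm 1 n) (hD.comp_mem
    (hD.tensor_mem hD.id_mem (bend_mem hD hNC hf)) (cup_adjoint_mem hD))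
  convert h using 1
  ext i j
  rw [Matrix.mul_apply, Finset.sum_eq_single (fun _ => i 0)]
  · simp only [tensor, cup, Matrix.conjTranspose_apply, if_true, star_one, mul_one]
    have h1 : (fun b : Fin 1 => i (Fin.cast (Nat.add_comm 1 n) (Fin.castAdd n b))) =
        fun _ => i 0 := by
      funext b; congr 1; ext; simp
    rw [h1, Matrix.one_apply_eq, one_mul]
    congr 1
    · congr 1
      funext x
      congr 1
      ext; simp
    · exact Subsingleton.elim _ _
  · intro s _ hs
    by_cases h : s 0 = s 1
    · simp only [tensor]
      rw [Matrix.one_apply_ne, zero_mul, zero_mul]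
      intro h'
      apply hs
      have h2 := congrFun h' 0
      have h3 : i 0 = s 0 := by
        refine Eq.trans ?_ h2
        congr 1
      funext b
      fin_cases b
      · exact h3.symm
      · exact h.symm.trans h3.symm
    · simp [cup, h]
  · simp

include hNC in
/-- Summation over the last index. -/
theorem sum_last_mem {n : ℕ} {f : Mat N 0 (n + 1)} (hf : f ∈ D 0 (n + 1)) :
    (fun i j => ∑ a : Fin N, f (Fin.snoc i a) j : Mat N 0 n) ∈ D 0 n := by
  have h : (tensor (k := n) (l := n) 1 (partMat N (⊤ : Partition 1 0)) : Mat N (n + 1) n) ∈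
      D (n + 1) n := hD.tensor_mem (one_mem hD hNC n) (partMat_mem hNC (not_isCrossing_top 1 0))
  refine Eq.subst (motive := (· ∈ D 0 n)) ?_ (hD.comp_mem h hf)
  ext i j
  refine (tensor_one_mul_apply (n := n) (a := 1) (b := 0) _ f i j).trans ?_
  rw [← (Equiv.funUnique (Fin 1) (Fin N)).symm.sum_comp]
  refine Finset.sum_congr rfl fun a _ => ?_
  have h1 : ∀ u v, partMat N (⊤ : Partition 1 0) u v = 1 := by
    intro u v
    rw [partMat, if_pos]
    rintro (x | x) (y | y) -
    · rw [Subsingleton.elim x y]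
    all_goals exact Fin.elim0 (by assumption)
  rw [h1, one_mul]
  refine congrArg (fun u => f u j) (funext fun x => ?_)
  induction x using Fin.lastCases with
  | last =>
    rw [Fin.snoc_last]
    exact Fin.append_right (fun x => i (Fin.castAdd 0 x)) (fun _ : Fin 1 => a) (0 : Fin 1)
  | cast x =>
    rw [Fin.snoc_castSucc]
    exact Fin.append_left (fun x => i (Fin.castAdd 0 x)) (fun _ : Fin 1 => a) x

include hNC in
/-- Identification of the last two indices. -/
theorem merge_last_mem {n : ℕ} {f : Mat N 0 (n + 2)} (hf : f ∈ D 0 (n + 2)) :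
    (fun i j => f (Fin.snoc i (i (Fin.last n))) j : Mat N 0 (n + 1)) ∈ D 0 (n + 1) := by
  have h : (tensor (k := n) (l := n) 1 (partMat N (⊤ : Partition 2 1)) : Mat N (n + 2) (n + 1)) ∈
      D (n + 2) (n + 1) :=
    hD.tensor_mem (one_mem hD hNC n) (partMat_mem hNC (not_isCrossing_top 2 1))
  refine Eq.subst (motive := (· ∈ D 0 (n + 1))) ?_ (hD.comp_mem h hf)
  ext i j
  refine (tensor_one_mul_apply _ f i j).trans ?_
  rw [Finset.sum_eq_single (fun _ => i (Fin.last n))]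
  · rw [partMat, if_pos, one_mul]
    · congr 1
      funext x
      induction x using Fin.lastCases with
      | last =>
        rw [Fin.snoc_last]
        exact Fin.append_right (fun x => i (Fin.castAdd 1 x)) (fun _ : Fin 2 => _) (1 : Fin 2)
      | cast x =>
        rw [Fin.snoc_castSucc]
        induction x using Fin.lastCases with
        | last => exact Fin.append_right (fun x => i (Fin.castAdd 1 x)) (fun _ : Fin 2 => _) (0 : Fin 2)
        | cast x => exact Fin.append_left (fun x => i (Fin.castAdd 1 x)) (fun _ : Fin 2 => _) x
    · have h1 : ∀ x : Fin 1, i (Fin.natAdd n x) = i (Fin.last n) := by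
        intro x; congr 1; ext; simp
      rintro (x | x) (y | y) - <;> simp [h1]
  · intro s _ hs
    rw [partMat, if_neg, zero_mul]
    intro h
    apply hs
    funext x
    exact h (Sum.inl x) (Sum.inr 0) trivial
  · simp

end IsDual

/-! ### The spaces of P as the invariants of the symmetric group -/

/-- The matrices commuting with the permutation action. -/
def IsInvariant {k l : ℕ} (T : Mat N k l) : Prop :=
  ∀ (σ : Equiv.Perm (Fin N)) (i : Fin l → Fin N) (j : Fin k → Fin N),
    T (fun x => σ (i x)) (fun x => σ (j x)) = T i j

/-- The partition of positions into places of equal letters. -/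
abbrev kernelPartition {k l : ℕ} (i : Fin l → Fin N) (j : Fin k → Fin N) : Partition k l :=
  Setoid.ker (Sum.elim j i)

open Classical in
/-- The matrix unit of the orbit of words with kernel `p`. -/
noncomputable def orbitMat (N : ℕ) {k l : ℕ} (p : Partition k l) : Mat N k l :=
  fun i j => if kernelPartition i j = p then 1 else 0

theorem partMat_apply {k l : ℕ} (p : Partition k l) (i : Fin l → Fin N) (j : Fin k → Fin N) :
    partMat N p i j = open Classical in if p ≤ kernelPartition i j then 1 else 0 := by
  rw [partMat]
  congr 1

instance finite_partition {k l : ℕ} : Finite (Partition k l) :=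
  Finite.of_injective (fun p : Partition k l => fun x y => p x y) fun _ _ h =>
    Setoid.ext fun x y => iff_of_eq (congrFun (congrFun h x) y)

/-- `partMat N p` is the sum of the orbit matrices of all `q ≥ p`. This triangular system is
inverted by induction from the coarsest partition downwards. -/
theorem orbitMat_mem_homP {k l : ℕ} (p : Partition k l) : orbitMat N p ∈ homP N k l := by
  classical
  have : Fintype (Partition k l) := Fintype.ofFinite _
  induction p using WellFoundedGT.induction with
  | ind p ih =>
  have h : orbitMat N p = partMat N p - ∑ q ∈ Finset.univ.filter (p < ·), orbitMat N q := by
    ext i j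
    rw [Matrix.sub_apply, Matrix.sum_apply, partMat_apply]
    simp only [orbitMat, Finset.sum_ite_eq, Finset.mem_filter, Finset.mem_univ, true_and]
    by_cases h1 : kernelPartition i j = p
    · simp [h1]
    · have h2 : p < kernelPartition i j ↔ p ≤ kernelPartition i j :=
        ⟨le_of_lt, fun h => lt_of_le_of_ne h (Ne.symm h1)⟩
      simp [h1, h2]
  rw [h]
  exact Submodule.sub_mem _ (Submodule.subset_span ⟨p, rfl⟩)
    (Submodule.sum_mem _ fun q hq => ih q (Finset.mem_filter.1 hq).2)

theorem isInvariant_of_mem_homP {k l : ℕ} {T : Mat N k l} (hT : T ∈ homP N k l) :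
    IsInvariant T := by
  intro σ i j
  induction hT using Submodule.span_induction with
  | mem T hT =>
    obtain ⟨p, rfl⟩ := hT
    have h : kernelPartition (fun x => σ (i x)) (fun x => σ (j x)) = kernelPartition i j := by
      ext x y
      have h1 : ∀ z, Sum.elim (fun x => σ (j x)) (fun x => σ (i x)) z = σ (Sum.elim j i z) := by
        rintro (z | z) <;> rfl
      change Sum.elim (fun x => σ (j x)) (fun x => σ (i x)) x =
        Sum.elim (fun x => σ (j x)) (fun x => σ (i x)) y ↔ Sum.elim j i x = Sum.elim j i y
      rw [h1 x, h1 y, EmbeddingLike.apply_eq_iff_eq]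
    rw [partMat_apply, partMat_apply, h]
  | zero => rfl
  | add S T _ _ hS hT => rw [Matrix.add_apply, Matrix.add_apply, hS, hT]
  | smul a T _ hT => rw [Matrix.smul_apply, Matrix.smul_apply, hT]

/-- Equal kernels make `u x ↦ v x` a bijection between the ranges, and on a finite set it extends to
a permutation. -/
theorem exists_perm_of_ker_eq {α : Type*} {u v : α → Fin N}
    (h : Setoid.ker u = Setoid.ker v) : ∃ σ : Equiv.Perm (Fin N), ∀ x, σ (u x) = v x := by
  classical
  have h1 : ∀ x y, u x = u y ↔ v x = v y := fun x y => Setoid.ext_iff.1 h x y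
  let e : Set.range u ≃ Set.range v := by
    refine Equiv.ofBijective
      (fun a => ⟨v (Classical.choose a.2), Set.mem_range_self _⟩) ⟨?_, ?_⟩
    · rintro ⟨a, ha⟩ ⟨b, hb⟩ hab
      have h2 := (h1 _ _).2 (Subtype.ext_iff.1 hab)
      exact Subtype.ext ((Classical.choose_spec ha).symm.trans
        (h2.trans (Classical.choose_spec hb)))
    · rintro ⟨_, x, rfl⟩
      refine ⟨⟨u x, Set.mem_range_self x⟩, Subtype.ext ?_⟩
      exact (h1 _ _).1 (Classical.choose_spec (Set.mem_range_self (f := u) x))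
  refine ⟨e.extendSubtype, fun x => ?_⟩
  rw [e.extendSubtype_apply_of_mem _ (Set.mem_range_self x)]
  exact (h1 _ _).1 (Classical.choose_spec (Set.mem_range_self (f := u) x))

/-- An invariant matrix is constant on orbits, and the orbits are the sets of words with a given
kernel. Closure of P under composition and bending then needs no calculus of partitions. -/
theorem mem_homP_iff {k l : ℕ} {T : Mat N k l} : T ∈ homP N k l ↔ IsInvariant T := by
  classical
  refine ⟨isInvariant_of_mem_homP, fun hT => ?_⟩
  have : Fintype (Partition k l) := Fintype.ofFinite _
  have h : ∀ p : Partition k l, ∃ t : ℂ, ∀ (i : Fin l → Fin N) (j : Fin k → Fin N),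
      kernelPartition i j = p → T i j = t := by
    intro p
    by_cases hp : ∃ (i : Fin l → Fin N) (j : Fin k → Fin N), kernelPartition i j = p
    · obtain ⟨i, j, hij⟩ := hp
      refine ⟨T i j, fun i' j' h' => ?_⟩
      obtain ⟨σ, hσ⟩ := exists_perm_of_ker_eq (hij.trans h'.symm)
      have h1 : i' = fun x => σ (i x) := funext fun x => (hσ (Sum.inr x)).symm
      have h2 : j' = fun x => σ (j x) := funext fun x => (hσ (Sum.inl x)).symm
      rw [h1, h2, hT]
    -- No word over `N` letters has kernel `p`, so the value is irrelevant.
    · exact ⟨0, fun i j hij => absurd ⟨i, j, hij⟩ hp⟩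
  choose t ht using h
  have h : T = ∑ p, t p • orbitMat N p := by
    ext i j
    rw [Matrix.sum_apply, ht _ i j rfl]
    simp [orbitMat]
  rw [h]
  exact Submodule.sum_mem _ fun p _ => Submodule.smul_mem _ _ (orbitMat_mem_homP p)

theorem isDual_homP (N : ℕ) : IsDual (homP N) where
  tensor_mem := by
    intro k l k' l' S T hS hT
    rw [mem_homP_iff] at *
    intro σ i j
    exact congrArg₂ (· * ·) (hS σ _ _) (hT σ _ _)
  comp_mem := by
    intro k l r S T hS hT
    rw [mem_homP_iff] at *
    intro σ i j
    rw [Matrix.mul_apply, Matrix.mul_apply, ← (Equiv.piCongrRight fun _ : Fin l => σ).sum_comp]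
    exact Finset.sum_congr rfl fun s _ => congrArg₂ (· * ·) (hS σ _ _) (hT σ _ _)
  adjoint_mem := by
    intro k l T hT
    rw [mem_homP_iff] at *
    intro σ i j
    exact congrArg star (hT σ _ _)
  id_mem := by
    rw [mem_homP_iff]
    intro σ i j
    rw [Matrix.one_apply, Matrix.one_apply]
    refine if_congr ?_ rfl rfl
    simp [funext_iff]
  cup_mem := by
    rw [mem_homP_iff]
    intro σ i j
    simp [cup]

theorem homNC_le_homP (N : ℕ) : homNC N ≤ homP N := fun _ _ =>
  Submodule.span_mono fun _ ⟨p, _, h⟩ => ⟨p, h⟩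

/-! ### Partitions encoded by words -/

/-- The partition of a lower row into the places of equal letters of a word. -/
abbrev wordPartition {n : ℕ} (w : Fin n → ℕ) : Partition 0 n :=
  Setoid.ker (Sum.elim (fun _ : Fin 0 => 0) w)

/-- The vector `ξ_p` of the partition of a word. -/
noncomputable def wordMat (N : ℕ) {n : ℕ} (w : Fin n → ℕ) : Mat N 0 n := partMat N (wordPartition w)

open Classical in
theorem wordMat_apply {n : ℕ} (w : Fin n → ℕ) (i : Fin n → Fin N) (j : Fin 0 → Fin N) :
    wordMat N w i j = if ∀ x y, w x = w y → i x = i y then 1 else 0 := by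
  refine if_congr ⟨fun h x y => h (Sum.inr x) (Sum.inr y), ?_⟩ rfl rfl
  rintro h (x | x) (y | y)
  · exact x.elim0
  · exact x.elim0
  · exact y.elim0
  · exact h x y

theorem isCrossing_wordPartition_iff {n : ℕ} {w : Fin n → ℕ} :
    (wordPartition w).IsCrossing ↔
      ∃ a b c d : Fin n, a < b ∧ b < c ∧ c < d ∧ w a = w c ∧ w b = w d ∧ w a ≠ w b := by
  constructor
  · rintro ⟨x₁ | d, x₂ | c, x₃ | b, x₄ | a, h1, h2, h3, h4, h5, h6⟩
    case inr.inr.inr.inr =>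
      have h4 : w d = w b := h4
      have h5 : w c = w a := h5
      have h6 : ¬ w d = w c := h6
      simp only [position, Sum.elim_inr, Fin.val_rev] at h1 h2 h3
      refine ⟨a, b, c, d, ?_, ?_, ?_, h5.symm, h4.symm, ?_⟩
      · rw [Fin.lt_def]; omega
      · rw [Fin.lt_def]; omega
      · rw [Fin.lt_def]; omega
      · rw [← h4, ← h5]; exact Ne.symm h6
    all_goals exact Fin.elim0 (by assumption)
  · rintro ⟨a, b, c, d, h1, h2, h3, h4, h5, h6⟩
    refine ⟨Sum.inr d, Sum.inr c, Sum.inr b, Sum.inr a, ?_, ?_, ?_, h5.symm, h4.symm, ?_⟩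
    · simp only [position, Sum.elim_inr, Fin.val_rev]; omega
    · simp only [position, Sum.elim_inr, Fin.val_rev]; omega
    · simp only [position, Sum.elim_inr, Fin.val_rev]; omega
    · intro h
      have h : w d = w c := h
      exact h6 (by rw [h4, h5, h])

theorem exists_eq_wordPartition {n : ℕ} (p : Partition 0 n) : ∃ w, p = wordPartition w := by
  obtain ⟨f, hf⟩ := Countable.exists_injective_nat (Quotient p)
  refine ⟨fun x => f (Quotient.mk p (Sum.inr x)), Setoid.ext fun x y => ?_⟩
  rcases x with x | x
  · exact x.elim0
  rcases y with y | y
  · exact y.elim0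
  exact (Quotient.eq (r := p)).symm.trans hf.eq_iff.symm

/-! ### The crossing of two pairs generates P -/

namespace IsDual

variable {D : Family N} (hD : IsDual D) (hNC : homNC N ≤ D)

theorem wordMat_mem_of_monotone (hNC : homNC N ≤ D) {n : ℕ} {w : Fin n → ℕ} (hw : Monotone w) :
    wordMat N w ∈ D 0 n := by
  refine partMat_mem hNC fun h => ?_
  obtain ⟨a, b, c, d, h1, h2, -, h4, -, h6⟩ := isCrossing_wordPartition_iff.1 h
  exact h6 (le_antisymm (hw h1.le) ((hw h2.le).trans_eq h4.symm))

include hD hNC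

/-- Bending the last two points of the crossing to the upper row gives two crossing strands. -/
theorem flip_mem (h : wordMat N ![0, 1, 0, 1] ∈ D 0 4) :
    (fun i j => if i 0 = j 1 ∧ i 1 = j 0 then 1 else 0 : Mat N 2 2) ∈ D 2 2 := by
  refine Eq.subst (motive := (· ∈ D 2 2)) ?_
    (bend_mem (l := 2) hD hNC (bend_mem (l := 3) hD hNC h))
  ext i j
  rw [wordMat_apply]
  refine if_congr ?_ rfl rfl
  have h0 : ∀ (u : Fin 3 → Fin N) a, (Fin.snoc u a : Fin 4 → Fin N) = ![u 0, u 1, u 2, a] := by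
    intro u a
    funext x
    fin_cases x <;> rfl
  have h1 : ∀ (u : Fin 2 → Fin N) a, (Fin.snoc u a : Fin 3 → Fin N) = ![u 0, u 1, a] := by
    intro u a
    funext x
    fin_cases x <;> rfl
  rw [h0, h1]
  simp [Fin.forall_fin_succ]
  tauto

theorem swap_last_mem (h : wordMat N ![0, 1, 0, 1] ∈ D 0 4) {n : ℕ} {f : Mat N 0 (n + 2)}
    (hf : f ∈ D 0 (n + 2)) :
    (fun i j => f (fun x => i (Equiv.swap (Fin.last n).castSucc (Fin.last (n + 1)) x)) j :
      Mat N 0 (n + 2)) ∈ D 0 (n + 2) := by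
  have h' := hD.tensor_mem (one_mem hD hNC n) (flip_mem hD hNC h)
  refine Eq.subst (motive := (· ∈ D 0 (n + 2))) ?_ (hD.comp_mem h' hf)
  ext i j
  refine (tensor_one_mul_apply (n := n) (a := 2) (b := 2) _ f i j).trans ?_
  have e0 : (Fin.natAdd n (0 : Fin 2)) = (Fin.last n).castSucc := by ext; simp
  have e1 : (Fin.natAdd n (1 : Fin 2)) = Fin.last (n + 1) := by ext; simp
  rw [Finset.sum_eq_single ![i (Fin.last (n + 1)), i (Fin.last n).castSucc]]
  · simp only [e0, e1]
    simp only [Matrix.cons_val_zero, Matrix.cons_val_one, and_self, if_true, one_mul]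
    congr 1
    funext x
    induction x using Fin.addCases with
    | left x =>
      rw [Fin.append_left, Equiv.swap_apply_of_ne_of_ne]
      · rw [← e0, Ne, Fin.ext_iff]; simp; omega
      · rw [← e1, Ne, Fin.ext_iff]; simp; omega
    | right x =>
      rw [Fin.append_right]
      fin_cases x
      · simp [e0]
      · simp [e1]
  · intro s _ hs
    rw [if_neg, zero_mul]
    rintro ⟨h0, h1⟩
    apply hs
    funext x
    simp only [e0] at h0
    simp only [e1] at h1
    fin_cases x
    · exact h1.symm
    · exact h0.symm
  · simp

/-- The permutations of the positions under which a family is closed. -/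
def positionPerms (D : Family N) (n : ℕ) : Submonoid (Equiv.Perm (Fin n)) where
  carrier := {σ | ∀ f ∈ D 0 n, (fun i j => f (fun x => i (σ x)) j : Mat N 0 n) ∈ D 0 n}
  one_mem' := fun _ hf => hf
  mul_mem' := fun hσ hτ _ hf => hσ _ (hτ _ hf)

omit hD hNC in
theorem finRotate_apply_eq_snoc {α : Type*} {n : ℕ} (i : Fin (n + 1) → α) :
    (fun x => i (finRotate (n + 1) x)) = Fin.snoc (fun x : Fin n => i x.succ) (i 0) := by
  funext x
  induction x using Fin.lastCases with
  | last => rw [Fin.snoc_last, finRotate_last]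
  | cast x =>
    rw [Fin.snoc_castSucc]
    congr 1
    rw [finRotate_apply]
    simp

/-- The full cycle and one adjacent transposition generate the symmetric group. -/
theorem positionPerms_eq_top (h : wordMat N ![0, 1, 0, 1] ∈ D 0 4) (n : ℕ)
    (σ : Equiv.Perm (Fin n)) : σ ∈ positionPerms D n := by
  match n with
  | 0 => rw [Subsingleton.elim σ 1]; exact Submonoid.one_mem _
  | 1 => rw [Subsingleton.elim σ 1]; exact Submonoid.one_mem _
  | n + 2 =>
    have h1 : finRotate (n + 2) ∈ positionPerms D (n + 2) := by
      intro f hf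
      simp only [finRotate_apply_eq_snoc]
      exact rotate_mem hD hNC hf
    have h2 : Equiv.swap (Fin.last n).castSucc (finRotate (n + 2) (Fin.last n).castSucc) ∈
        positionPerms D (n + 2) := by
      have : finRotate (n + 2) (Fin.last n).castSucc = Fin.last (n + 1) := by
        rw [finRotate_apply]; simp
      rw [this]
      exact fun f hf => swap_last_mem hD hNC h hf
    have h3 := Equiv.Perm.closure_cycle_adjacent_swap (isCycle_finRotate (n := n))
      (support_finRotate (n := n)) (Fin.last n).castSucc
    have h4 : σ ∈ Subgroup.closure {finRotate (n + 2),
        Equiv.swap (Fin.last n).castSucc (finRotate (n + 2) (Fin.last n).castSucc)} :=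
      h3 ▸ Subgroup.mem_top σ
    induction h4 using Subgroup.closure_induction with
    | mem σ hσ =>
      rcases hσ with rfl | rfl
      · exact h1
      · exact h2
    | one => exact Submonoid.one_mem _
    | mul σ τ _ _ hσ hτ => exact Submonoid.mul_mem _ hσ hτ
    -- `positionPerms` is only a submonoid, but in a finite group the inverse is a nonnegative
    -- power.
    | inv σ _ hσ =>
      obtain ⟨k, hk⟩ := (mem_powers_iff_mem_zpowers (x := σ) (y := σ⁻¹)).2
        (Subgroup.inv_mem _ (Subgroup.mem_zpowers σ))
      rw [← hk]
      exact Submonoid.pow_mem _ hσ k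

/-- A family containing the crossing of two pairs contains all partitions. -/
theorem homP_le (h : wordMat N ![0, 1, 0, 1] ∈ D 0 4) : homP N ≤ D := by
  intro k
  induction k with
  | zero =>
    intro l
    refine Submodule.span_le.2 ?_
    rintro _ ⟨p, rfl⟩
    obtain ⟨w, rfl⟩ := exists_eq_wordPartition p
    -- The sorted word is noncrossing, and undoing the sort is a permutation of the points.
    have h1 := wordMat_mem_of_monotone (D := D) hNC (Tuple.monotone_sort w)
    have h2 := positionPerms_eq_top hD hNC h l (Tuple.sort w) _ h1
    refine Eq.subst (motive := (· ∈ D 0 l)) ?_ h2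
    ext i j
    rw [wordMat_apply]
    refine Eq.trans ?_ (wordMat_apply w i j).symm
    refine if_congr ?_ rfl rfl
    refine ⟨fun h x y hxy => ?_, fun h x y => h _ _⟩
    have := h ((Tuple.sort w).symm x) ((Tuple.sort w).symm y)
    simp only [Function.comp_apply, Equiv.apply_symm_apply] at this
    exact this hxy
  | succ k ih =>
    intro l T hT
    -- The last upper point is moved down, where the induction hypothesis applies, and then bent up
    -- again.
    have h1 : (fun i j => T (fun x => i x.castSucc) (Fin.snoc j (i (Fin.last l))) :
        Mat N k (l + 1)) ∈ D k (l + 1) := by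
      refine ih (l + 1) (mem_homP_iff.2 fun σ i j => ?_)
      refine Eq.trans ?_ (mem_homP_iff.1 hT σ _ _)
      congr 1
      exact (Fin.comp_snoc σ j _).symm
    refine Eq.subst (motive := (· ∈ D (k + 1) l)) ?_ (bend_mem hD hNC h1)
    ext i j
    congr 1
    · funext x; rw [Fin.snoc_castSucc]
    · rw [Fin.snoc_last]
      exact Fin.snoc_init_self j

end IsDual

/-! ### Rotation, merging and capping on words -/

theorem wordMat_congr {n : ℕ} {v w : Fin n → ℕ} (h : ∀ x y, v x = v y ↔ w x = w y) :
    wordMat N v = wordMat N w := by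
  ext i j
  rw [wordMat_apply, wordMat_apply]
  simp only [h]

theorem wordMat_rotate {n : ℕ} (w : Fin (n + 1) → ℕ) (i : Fin (n + 1) → Fin N)
    (j : Fin 0 → Fin N) :
    wordMat N (fun x => w (finRotate (n + 1) x)) (fun x => i (finRotate (n + 1) x)) j =
      wordMat N w i j := by
  rw [wordMat_apply, wordMat_apply]
  refine if_congr ⟨fun h x y hxy => ?_, fun h x y => h _ _⟩ rfl rfl
  have := h ((finRotate (n + 1)).symm x) ((finRotate (n + 1)).symm y)
  simp only [Equiv.apply_symm_apply] at this
  exact this hxy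

/-- Identification of the last two letters. -/
def mergeWord {n : ℕ} (w : Fin (n + 2) → ℕ) : Fin (n + 1) → ℕ := fun x =>
  if w x.castSucc = w (Fin.last (n + 1)) then w (Fin.last n).castSucc else w x.castSucc

theorem wordMat_merge {n : ℕ} (w : Fin (n + 2) → ℕ) (i : Fin (n + 1) → Fin N)
    (j : Fin 0 → Fin N) :
    wordMat N w (Fin.snoc i (i (Fin.last n))) j = wordMat N (mergeWord w) i j := by
  rw [wordMat_apply, wordMat_apply]
  refine if_congr ⟨fun h x y hxy => ?_, fun h x y hxy => ?_⟩ rfl rfl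
  · have h1 : ∀ x : Fin (n + 1), w x.castSucc = w (Fin.last (n + 1)) → i x = i (Fin.last n) := by
      intro x hx
      have := h _ _ hx
      rwa [Fin.snoc_castSucc, Fin.snoc_last] at this
    have h2 : ∀ x y : Fin (n + 1), w x.castSucc = w y.castSucc → i x = i y := by
      intro x y hx
      have := h _ _ hx
      rwa [Fin.snoc_castSucc, Fin.snoc_castSucc] at this
    unfold mergeWord at hxy
    split_ifs at hxy with h3 h4 h4
    · rw [h1 x h3, h1 y h4]
    · rw [h1 x h3, h2 _ _ hxy]
    · rw [h1 y h4, h2 _ _ hxy]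
    · exact h2 _ _ hxy
  · have h1 : mergeWord w (Fin.last n) = w (Fin.last n).castSucc := by
      unfold mergeWord; split_ifs <;> rfl
    have h2 : ∀ x : Fin (n + 1), w x.castSucc = w (Fin.last (n + 1)) → i x = i (Fin.last n) := by
      intro x hx
      refine h _ _ ?_
      rw [h1, mergeWord, if_pos hx]
    induction x using Fin.lastCases with
    | last =>
      induction y using Fin.lastCases with
      | last => rfl
      | cast y => rw [Fin.snoc_last, Fin.snoc_castSucc, h2 y hxy.symm]
    | cast x =>
      induction y using Fin.lastCases with
      | last => rw [Fin.snoc_last, Fin.snoc_castSucc, h2 x hxy]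
      | cast y =>
        rw [Fin.snoc_castSucc, Fin.snoc_castSucc]
        refine h _ _ ?_
        unfold mergeWord
        rw [hxy]

/-- A last point joined to an earlier one carries a forced letter and contributes 1. A last point
alone in its block is free and contributes `N`. -/
theorem sum_wordMat_snoc {n : ℕ} (w : Fin (n + 1) → ℕ) (i : Fin n → Fin N)
    (j : Fin 0 → Fin N) :
    ∑ a : Fin N, wordMat N w (Fin.snoc i a) j =
      (if ∃ x : Fin n, w x.castSucc = w (Fin.last n) then 1 else (N : ℂ)) *
        wordMat N (fun x : Fin n => w x.castSucc) i j := by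
  classical
  simp only [wordMat_apply]
  by_cases hw : ∀ x y : Fin n, w x.castSucc = w y.castSucc → i x = i y
  · have h1 : ∀ a : Fin N, (∀ x y : Fin (n + 1), w x = w y →
        (Fin.snoc i a : Fin (n + 1) → Fin N) x = (Fin.snoc i a : Fin (n + 1) → Fin N) y) ↔
        ∀ x : Fin n, w x.castSucc = w (Fin.last n) → i x = a := by
      intro a
      refine ⟨fun h x hx => ?_, fun h x y hxy => ?_⟩
      · have := h _ _ hx
        rwa [Fin.snoc_castSucc, Fin.snoc_last] at this
      · induction x using Fin.lastCases with
        | last =>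
          induction y using Fin.lastCases with
          | last => rfl
          | cast y => rw [Fin.snoc_last, Fin.snoc_castSucc, h y hxy.symm]
        | cast x =>
          induction y using Fin.lastCases with
          | last => rw [Fin.snoc_last, Fin.snoc_castSucc, h x hxy]
          | cast y => rw [Fin.snoc_castSucc, Fin.snoc_castSucc, hw x y hxy]
    rw [if_pos hw, mul_one]
    simp only [h1]
    split_ifs with h
    · obtain ⟨x, hx⟩ := h
      rw [Finset.sum_eq_single (i x)]
      · rw [if_pos fun y hy => hw _ _ (hy.trans hx.symm)]
      · intro a _ ha
        exact if_neg fun h => ha (h x hx).symm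
      · simp
    · rw [Finset.sum_congr rfl fun a _ => if_pos fun x hx => absurd ⟨x, hx⟩ h]
      simp
  · rw [if_neg hw, mul_zero]
    refine Finset.sum_eq_zero fun a _ => if_neg fun h => hw fun x y hxy => ?_
    have := h _ _ hxy
    rwa [Fin.snoc_castSucc, Fin.snoc_castSucc] at this

/-! ### Canonical words as lists, for evaluation -/

/-- The letters of a list of length `n`. -/
def letters (n : ℕ) (l : List ℕ) : Fin n → ℕ := fun x => l.getD x 0

/-- The list of the letters of a word, each replaced by the place of its first occurrence. -/
def firstPlaces {n : ℕ} (w : Fin n → ℕ) : List ℕ :=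
  (List.ofFn w).map fun a => (List.ofFn w).idxOf a

theorem letters_firstPlaces_eq_iff {n : ℕ} (w : Fin n → ℕ) (x y : Fin n) :
    letters n (firstPlaces w) x = letters n (firstPlaces w) y ↔ w x = w y := by
  have h : ∀ x : Fin n, letters n (firstPlaces w) x = (List.ofFn w).idxOf (w x) := by
    intro x
    simp [letters, firstPlaces, List.getD_eq_getElem?_getD]
  rw [h, h, List.idxOf_inj ((List.mem_ofFn).2 ⟨x, rfl⟩)]

/-- The vector `ξ_p` of the partition of the places of equal letters of a list. -/
noncomputable def listMat (N n : ℕ) (l : List ℕ) : Mat N 0 n := wordMat N (letters n l)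

theorem listMat_firstPlaces {n : ℕ} (w : Fin n → ℕ) :
    listMat N n (firstPlaces w) = wordMat N w :=
  wordMat_congr (letters_firstPlaces_eq_iff w)

/-- Cyclic rotation of the places. -/
def rotateList (n : ℕ) (l : List ℕ) : List ℕ :=
  firstPlaces fun x : Fin (n + 1) => letters (n + 1) l (x + 1)

def mergeList (n : ℕ) (l : List ℕ) : List ℕ := firstPlaces (mergeWord (letters (n + 2) l))

def initList (n : ℕ) (l : List ℕ) : List ℕ :=
  firstPlaces fun x : Fin n => letters (n + 1) l x.castSucc

/-- The last letter occurs only once. -/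
def LastIsSingle (n : ℕ) (l : List ℕ) : Prop :=
  ¬ ∃ x : Fin n, letters (n + 1) l x.castSucc = letters (n + 1) l (Fin.last n)

instance (n : ℕ) (l : List ℕ) : Decidable (LastIsSingle n l) := by
  unfold LastIsSingle; infer_instance

/-- The word has a crossing. -/
def Crosses {n : ℕ} (w : Fin n → ℕ) : Prop :=
  ∃ a b : Fin n, (a < b ∧ w a ≠ w b) ∧ ∃ c, (b < c ∧ w a = w c) ∧ ∃ d, c < d ∧ w b = w d

instance {n : ℕ} (w : Fin n → ℕ) : Decidable (Crosses w) := by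
  unfold Crosses; infer_instance

theorem isCrossing_wordPartition_iff_crosses {n : ℕ} {w : Fin n → ℕ} :
    (wordPartition w).IsCrossing ↔ Crosses w := by
  rw [isCrossing_wordPartition_iff]
  constructor
  · rintro ⟨a, b, c, d, h1, h2, h3, h4, h5, h6⟩
    exact ⟨a, b, ⟨h1, h6⟩, c, ⟨h2, h4⟩, d, h3, h5⟩
  · rintro ⟨a, b, ⟨h1, h6⟩, c, ⟨h2, h4⟩, d, h3, h5⟩
    exact ⟨a, b, c, d, h1, h2, h3, h4, h5, h6⟩

/-- A list containing the canonical words of length `n`. -/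
def allWords : ℕ → List (List ℕ)
  | 0 => [[]]
  | n + 1 => (allWords n).flatMap fun l => (n :: l).map fun a => l ++ [a]

theorem map_idxOf_mem_allWords (l : List ℕ) : (l.map fun a => l.idxOf a) ∈ allWords l.length := by
  induction l using List.reverseRecOn with
  | nil => simp [allWords]
  | append_singleton l a ih =>
    rw [List.length_append, List.length_singleton, allWords, List.mem_flatMap]
    refine ⟨_, ih, List.mem_map.2 ⟨(l ++ [a]).idxOf a, ?_, ?_⟩⟩
    · by_cases ha : a ∈ l
      · rw [List.idxOf_append_of_mem ha]
        exact List.mem_cons_of_mem _ (List.mem_map.2 ⟨a, ha, rfl⟩)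
      · rw [List.idxOf_append_of_notMem ha]
        simp
    · rw [List.map_append]
      congr 1
      exact List.map_congr_left fun b hb => (List.idxOf_append_of_mem hb).symm

theorem firstPlaces_mem_allWords {n : ℕ} (w : Fin n → ℕ) : firstPlaces w ∈ allWords n := by
  have := map_idxOf_mem_allWords (List.ofFn w)
  rwa [List.length_ofFn] at this

theorem crosses_congr {n : ℕ} {v w : Fin n → ℕ} (h : ∀ x y, v x = v y ↔ w x = w y) :
    Crosses v ↔ Crosses w := by
  simp only [Crosses, h, Ne]

/-! ### Linear independence modulo a dual, and the equations it yields -/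

/-- The vectors of the words in `S` are linearly independent modulo `D`. -/
def IsSeparated (D : Family N) (n : ℕ) (S : Finset (List ℕ)) : Prop :=
  ∀ c : List ℕ → ℂ, ∑ w ∈ S, c w • listMat N n w ∈ D 0 n → ∀ w ∈ S, c w = 0

/-- The image under `Φ` of a relation modulo `D` is again one. Its noncrossing terms lie in `D` and
drop out, and separation of `S'` kills what is collected over each remaining word. -/
theorem IsSeparated.sum_fiber_eq_zero {D : Family N} (hNC : homNC N ≤ D) {m n : ℕ}
    {S S' : Finset (List ℕ)} (hS' : IsSeparated D n S') {op : List ℕ → List ℕ}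
    {t : List ℕ → ℂ} (hop : ∀ w ∈ S, op w ∈ S' ∨ ¬ Crosses (letters n (op w)))
    {Φ : Mat N 0 m →ₗ[ℂ] Mat N 0 n} (hΦ : ∀ f ∈ D 0 m, Φ f ∈ D 0 n)
    (hΦw : ∀ w, Φ (listMat N m w) = t w • listMat N n (op w))
    {c : List ℕ → ℂ} (hc : ∑ w ∈ S, c w • listMat N m w ∈ D 0 m) {r : List ℕ} (hr : r ∈ S') :
    ∑ w ∈ S with op w = r, t w * c w = 0 := by
  have h1 := hΦ _ hc
  rw [map_sum] at h1
  have h2 : ∀ w ∈ S, Φ (c w • listMat N m w) = (t w * c w) • listMat N n (op w) := by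
    intro w _
    rw [map_smul, hΦw, smul_smul, mul_comm]
  rw [Finset.sum_congr rfl h2, ← Finset.sum_filter_add_sum_filter_not S (op · ∈ S')] at h1
  have h3 : ∑ w ∈ S with op w ∉ S', (t w * c w) • listMat N n (op w) ∈ D 0 n := by
    refine Submodule.sum_mem _ fun w hw => Submodule.smul_mem _ _ ?_
    rw [Finset.mem_filter] at hw
    refine IsDual.partMat_mem hNC ?_
    rw [isCrossing_wordPartition_iff_crosses]
    exact (hop w hw.1).resolve_left hw.2
  have h4 := (Submodule.add_mem_iff_left _ h3).1 h1
  have h5 : ∑ w ∈ S with op w ∈ S', (t w * c w) • listMat N n (op w) =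
      ∑ r ∈ S', (∑ w ∈ S with op w = r, t w * c w) • listMat N n r := by
    rw [← Finset.sum_fiberwise_of_maps_to (g := op) (t := S')
      (fun w hw => (Finset.mem_filter.1 hw).2)]
    refine Finset.sum_congr rfl fun r hr => ?_
    rw [Finset.sum_smul, Finset.filter_filter]
    refine Finset.sum_congr ?_ fun w hw => ?_
    · ext w
      simp only [Finset.mem_filter]
      refine and_congr_right fun _ => ⟨fun h => h.2, fun h => ⟨h ▸ hr, h⟩⟩
    · rw [(Finset.mem_filter.1 hw).2]
  rw [h5] at h4
  exact hS' _ h4 r hr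

/-- Substitution of words, as a linear map. -/
def substitute (N : ℕ) {m n : ℕ} (φ : (Fin n → Fin N) → Fin m → Fin N) :
    Mat N 0 m →ₗ[ℂ] Mat N 0 n where
  toFun f := fun i j => f (φ i) j
  map_add' _ _ := rfl
  map_smul' _ _ := rfl

section

variable {D : Family N} (hD : IsDual D) (hNC : homNC N ≤ D)
include hD hNC

/-- Merging and capping act on the last points only. Rotating the coefficients makes them available
at every place. -/
theorem IsDual.rotateList_mem {n : ℕ} {S : Finset (List ℕ)}
    (hS : ∀ w ∈ S, rotateList n w ∈ S) (hn : ∀ w ∈ S, (rotateList n)^[n + 1] w = w)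
    {c : List ℕ → ℂ} (hc : ∑ w ∈ S, c w • listMat N (n + 1) w ∈ D 0 (n + 1)) (k : ℕ) :
    ∑ w ∈ S, c ((rotateList n)^[k] w) • listMat N (n + 1) w ∈ D 0 (n + 1) := by
  induction k with
  | zero => exact hc
  | succ k ih =>
    have h0 : ∀ k, ∀ w ∈ S, (rotateList n)^[k] w ∈ S := by
      intro k
      induction k with
      | zero => exact fun w hw => hw
      | succ k ih =>
        intro w hw
        rw [Function.iterate_succ_apply']
        exact hS _ (ih w hw)
    have h1 : ∑ w ∈ S, c ((rotateList n)^[k] w) • listMat N (n + 1) w =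
        ∑ w ∈ S, c ((rotateList n)^[k + 1] w) • listMat N (n + 1) (rotateList n w) := by
      refine Finset.sum_nbij' (rotateList n)^[n] (rotateList n) (h0 n) hS ?_ ?_ ?_
      · intro w hw
        rw [← Function.iterate_succ_apply' (rotateList n) n, hn w hw]
      · intro w hw
        rw [← Function.iterate_succ_apply, hn w hw]
      · intro w hw
        rw [Function.iterate_succ_apply, ← Function.iterate_succ_apply' (rotateList n) n, hn w hw]
    rw [h1] at ih
    have h2 := rotate_mem hD hNC ih
    refine Eq.subst (motive := (· ∈ D 0 (n + 1))) ?_ h2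
    ext i j
    rw [Matrix.sum_apply, Matrix.sum_apply]
    refine Finset.sum_congr rfl fun w _ =>
      congrArg (c ((rotateList n)^[k + 1] w) * ·) ?_
    have h3 := wordMat_rotate (letters (n + 1) w) i j
    rw [rotateList, listMat_firstPlaces, listMat, ← h3, finRotate_apply_eq_snoc i]
    simp only [finRotate_apply]

theorem IsSeparated.sum_mergeList_eq_zero {n : ℕ} {S S' : Finset (List ℕ)}
    (hS' : IsSeparated D (n + 1) S')
    (hop : ∀ w ∈ S, mergeList n w ∈ S' ∨ ¬ Crosses (letters (n + 1) (mergeList n w)))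
    {c : List ℕ → ℂ} (hc : ∑ w ∈ S, c w • listMat N (n + 2) w ∈ D 0 (n + 2))
    {r : List ℕ} (hr : r ∈ S') : ∑ w ∈ S with mergeList n w = r, c w = 0 := by
  have h := hS'.sum_fiber_eq_zero hNC (t := fun _ => 1) hop
    (Φ := substitute N fun i => Fin.snoc i (i (Fin.last n)))
    (fun f hf => hD.merge_last_mem hNC hf) ?_ hc hr
  · simpa only [one_mul] using h
  · intro w
    rw [one_smul, mergeList, listMat_firstPlaces]
    ext i j
    exact wordMat_merge _ i j

theorem IsSeparated.sum_initList_eq_zero {n : ℕ} {S S' : Finset (List ℕ)}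
    (hS' : IsSeparated D n S')
    (hop : ∀ w ∈ S, initList n w ∈ S' ∨ ¬ Crosses (letters n (initList n w)))
    {c : List ℕ → ℂ} (hc : ∑ w ∈ S, c w • listMat N (n + 1) w ∈ D 0 (n + 1))
    {r : List ℕ} (hr : r ∈ S') :
    ∑ w ∈ S with initList n w = r, (if LastIsSingle n w then (N : ℂ) else 1) * c w = 0 := by
  refine hS'.sum_fiber_eq_zero hNC hop
    (Φ := ∑ a : Fin N, substitute N fun i => Fin.snoc i a) (fun f hf => ?_) (fun w => ?_) hc hr
  · refine Eq.subst (motive := (· ∈ D 0 n)) ?_ (hD.sum_last_mem hNC hf)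
    ext i j
    rw [LinearMap.sum_apply, Matrix.sum_apply]
    rfl
  · rw [initList, listMat_firstPlaces]
    ext i j
    rw [LinearMap.sum_apply, Matrix.sum_apply]
    refine (sum_wordMat_snoc (letters (n + 1) w) i j).trans (congrArg (· * _) ?_)
    simp only [LastIsSingle, ite_not]

end

/-- The first `k` rotations of a word of length `n + 1`. -/
def orbit (n k : ℕ) (w : List ℕ) : List (List ℕ) :=
  (List.range k).map fun i => (rotateList n)^[i] w

section

variable {D : Family N} (hD : IsDual D) (hNC : homNC N ≤ D)
include hD hNC

/-- `E` names the words of the fibre over `r` by an orbit representative and a number of rotations,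
so rotating the equation `k` times only shifts arguments. -/
theorem IsSeparated.merge_equation {n : ℕ} {L : List (List ℕ)} {S' : Finset (List ℕ)}
    (hS' : IsSeparated D (n + 1) S') (hL : L.Nodup)
    (hr : ∀ w ∈ L.toFinset, rotateList (n + 1) w ∈ L.toFinset)
    (hn : ∀ w ∈ L.toFinset, (rotateList (n + 1))^[n + 2] w = w)
    (hop : ∀ w ∈ L.toFinset, mergeList n w ∈ S' ∨ ¬ Crosses (letters (n + 1) (mergeList n w)))
    {c : List ℕ → ℂ} (hc : ∑ w ∈ L.toFinset, c w • listMat N (n + 2) w ∈ D 0 (n + 2))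
    {r : List ℕ} (hr' : r ∈ S') (E : List (List ℕ × ℕ))
    (hE : L.filter (fun w => mergeList n w = r) =
      E.map fun e => (rotateList (n + 1))^[e.2] e.1) (k : ℕ) :
    (E.map fun e => c ((rotateList (n + 1))^[k + e.2] e.1)).sum = 0 := by
  have h := hS'.sum_mergeList_eq_zero hD hNC hop (hD.rotateList_mem hNC hr hn hc k) hr'
  have h1 : (L.toFinset.filter fun w => mergeList n w = r) =
      (L.filter fun w => mergeList n w = r).toFinset := by
    rw [List.toFinset_filter]
    simp
  rw [h1, List.sum_toFinset _ (hL.filter _), hE, List.map_map] at h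
  rw [← h]
  congr 1
  refine List.map_congr_left fun e _ => ?_
  rw [Function.comp_apply, Function.iterate_add_apply]

/-- The Boolean marks the words whose last point is a singleton; these enter with weight `N`. -/
theorem IsSeparated.cap_equation {n : ℕ} {L : List (List ℕ)} {S' : Finset (List ℕ)}
    (hS' : IsSeparated D n S') (hL : L.Nodup)
    (hr : ∀ w ∈ L.toFinset, rotateList n w ∈ L.toFinset)
    (hn : ∀ w ∈ L.toFinset, (rotateList n)^[n + 1] w = w)
    (hop : ∀ w ∈ L.toFinset, initList n w ∈ S' ∨ ¬ Crosses (letters n (initList n w)))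
    {c : List ℕ → ℂ} (hc : ∑ w ∈ L.toFinset, c w • listMat N (n + 1) w ∈ D 0 (n + 1))
    {r : List ℕ} (hr' : r ∈ S') (E : List (Bool × List ℕ × ℕ))
    (hE : L.filter (fun w => initList n w = r) =
      E.map fun e => (rotateList n)^[e.2.2] e.2.1)
    (hE' : ∀ e ∈ E, e.1 = decide (LastIsSingle n ((rotateList n)^[e.2.2] e.2.1))) (k : ℕ) :
    (E.map fun e => (if e.1 then (N : ℂ) else 1) *
      c ((rotateList n)^[k + e.2.2] e.2.1)).sum = 0 := by
  have h := hS'.sum_initList_eq_zero hD hNC hop (hD.rotateList_mem hNC hr hn hc k) hr'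
  have h1 : (L.toFinset.filter fun w => initList n w = r) =
      (L.filter fun w => initList n w = r).toFinset := by
    rw [List.toFinset_filter]
    simp
  rw [h1, List.sum_toFinset _ (hL.filter _), hE, List.map_map] at h
  rw [← h]
  congr 1
  refine List.map_congr_left fun e he => ?_
  rw [Function.comp_apply, Function.iterate_add_apply, hE' e he]
  simp only [decide_eq_true_eq]

omit hD hNC in
theorem isSeparated_four (hX : wordMat N ![0, 1, 0, 1] ∉ D 0 4) :
    IsSeparated D 4 {[0, 1, 0, 1]} := by
  intro c hc w hw
  rw [Finset.mem_singleton.1 hw]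
  by_contra h
  rw [Finset.sum_singleton] at hc
  refine hX ?_
  have h1 := (Submodule.smul_mem_iff _ h).1 hc
  rw [listMat] at h1
  have h2 : letters 4 [0, 1, 0, 1] = ![0, 1, 0, 1] := by decide
  rwa [h2] at h1

end

/-! ### Five points -/

/-- The crossing words of length five. -/
def crossing5 : List (List ℕ) := orbit 4 5 [0, 1, 2, 1, 2] ++ orbit 4 5 [0, 1, 0, 0, 1]

/-- Eliminating the coefficients `t` (a pair and a triple) leaves `(N - 2) s (k + 1) = s k + s (k +
2)` for the coefficients `s` (two pairs and a singleton), with period 5. A nonzero `s` would make `N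
- 2` an eigenvalue of the 5-cycle. These eigenvalues are 2 and the roots of `z² + z - 1`, that is `N
= 4` or `N² - 3N + 1 = 0`. -/
theorem isSeparated_five {D : Family N} (hD : IsDual D) (hNC : homNC N ≤ D)
    (hX : wordMat N ![0, 1, 0, 1] ∉ D 0 4) (h4 : (N : ℂ) - 4 ≠ 0)
    (hq : (N : ℂ) ^ 2 - 3 * N + 1 ≠ 0) : IsSeparated D 5 crossing5.toFinset := by
  intro c hc
  have hL : crossing5.Nodup := by decide +kernel
  have hr : ∀ w ∈ crossing5.toFinset, rotateList 4 w ∈ crossing5.toFinset := by decide +kernel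
  have hn : ∀ w ∈ crossing5.toFinset, (rotateList 4)^[5] w = w := by decide +kernel
  have hS := isSeparated_four hX
  have e1 := IsSeparated.merge_equation hD hNC (n := 3) hS hL hr hn (by decide +kernel) hc
    (Finset.mem_singleton_self _) [([0, 1, 2, 1, 2], 1), ([0, 1, 2, 1, 2], 2),
    ([0, 1, 0, 0, 1], 4)] (by decide +kernel)
  have e2 := IsSeparated.cap_equation hD hNC hS hL hr hn (by decide +kernel) hc
    (Finset.mem_singleton_self _) [(true, [0, 1, 2, 1, 2], 1), (false, [0, 1, 0, 0, 1], 3),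
    (false, [0, 1, 0, 0, 1], 4)] (by decide +kernel) (by decide +kernel)
  have hs5 : ∀ k, c ((rotateList 4)^[k + 5] [0, 1, 2, 1, 2]) =
      c ((rotateList 4)^[k] [0, 1, 2, 1, 2]) := by
    intro k
    rw [Function.iterate_add_apply, hn _ (by decide +kernel)]
  have ht5 : ∀ k, c ((rotateList 4)^[k + 5] [0, 1, 0, 0, 1]) =
      c ((rotateList 4)^[k] [0, 1, 0, 0, 1]) := by
    intro k
    rw [Function.iterate_add_apply, hn _ (by decide +kernel)]
  simp only [List.map_cons, List.map_nil, List.sum_cons, List.sum_nil, add_zero, if_true,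
    Bool.false_eq_true, if_false, one_mul] at e1 e2
  obtain ⟨s, hs⟩ : ∃ s : ℕ → ℂ, ∀ k, c ((rotateList 4)^[k] [0, 1, 2, 1, 2]) = s k :=
    ⟨_, fun _ => rfl⟩
  obtain ⟨t, ht⟩ : ∃ t : ℕ → ℂ, ∀ k, c ((rotateList 4)^[k] [0, 1, 0, 0, 1]) = t k :=
    ⟨_, fun _ => rfl⟩
  simp only [hs, ht] at e1 e2 hs5 ht5
  have e3 : ∀ k, (N - 2 : ℂ) * s (k + 1) = s k + s (k + 2) := by
    intro k
    have h1 := e1 (k + 4)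
    rw [show k + 4 + 1 = k + 5 by ring, show k + 4 + 2 = k + 1 + 5 by ring,
      show k + 4 + 4 = k + 3 + 5 by ring, hs5, hs5, ht5] at h1
    linear_combination e2 k - e1 k - h1
  have hs0 : ∀ k, s k = 0 := by
    intro k
    have h0 := e3 (k + 4)
    have h1 := e3 k
    have h2 := e3 (k + 1)
    have h3 := e3 (k + 2)
    have h4' := e3 (k + 3)
    simp only [add_assoc, Nat.reduceAdd, hs5] at h0 h1 h2 h3 h4'
    -- Summing the recurrence over a period excludes the eigenvalue 2. On vectors of sum zero, the
    -- quadratic factor decides.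
    have hsum : s k + s (k + 1) + s (k + 2) + s (k + 3) + s (k + 4) = 0 := by
      refine (mul_eq_zero.1 ?_).resolve_left h4
      linear_combination h0 + h1 + h2 + h3 + h4'
    refine (mul_eq_zero.1 ?_).resolve_left hq
    linear_combination (N - 2 : ℂ) * h0 + h1 + h4' + hsum + h0
  have ht0 : ∀ k, t k = 0 := by
    intro k
    have h1 := e1 (k + 1)
    rw [hs0, hs0, show k + 1 + 4 = k + 5 by ring, ht5] at h1
    simpa using h1
  intro w hw
  rw [List.mem_toFinset, crossing5, List.mem_append, orbit, List.mem_map, orbit, List.mem_map]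
    at hw
  rcases hw with ⟨k, _, rfl⟩ | ⟨k, _, rfl⟩
  · exact (hs k).trans (hs0 k)
  · exact (ht k).trans (ht0 k)

/-! ### Six points: the linear system and its solution -/

/-- The crossing words of length six, ordered by the cyclic symmetry. -/
def crossing6 : List (List ℕ) :=
  orbit 5 6 [0, 1, 2, 1, 2, 5] ++ orbit 5 6 [0, 1, 2, 1, 4, 2] ++ orbit 5 3 [0, 1, 2, 3, 1, 2] ++
  orbit 5 6 [0, 1, 2, 1, 2, 0] ++ orbit 5 6 [0, 1, 2, 2, 1, 2] ++ orbit 5 6 [0, 1, 1, 3, 1, 3] ++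
  orbit 5 6 [0, 1, 2, 1, 2, 1] ++ orbit 5 6 [0, 1, 2, 1, 2, 2] ++ orbit 5 6 [0, 1, 2, 1, 1, 2] ++
  orbit 5 6 [0, 1, 1, 1, 0, 1] ++ orbit 5 3 [0, 1, 1, 0, 1, 1] ++ orbit 5 6 [0, 1, 1, 0, 1, 0] ++
  orbit 5 1 [0, 1, 0, 1, 0, 1] ++ orbit 5 1 [0, 1, 2, 0, 1, 2] ++ orbit 5 3 [0, 1, 2, 1, 0, 2]

/-- The relations between the coefficients of a vector in `hom(0,6)` all of whose images in
`hom(0,4)` are noncrossing. Two singletons beside a crossing of two pairs: `g`, `h`, `j` for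
singletons at distance `1`, `2`, `3`. A single crossing of a pair and a triple beside a singleton:
`q₁, …, q₅`. Three pairs: `p`, `x`, `b`. A pair and a block of four: `r`, `u`. Two triples: `w`,
`a`. The arguments stand for rotations. -/
structure CrossingRelations (n : ℂ) (g h j p q₁ q₂ q₃ q₄ q₅ r u w a b x : ℕ → ℂ) : Prop where
  g_period : ∀ k, g (k + 6) = g k
  h_period : ∀ k, h (k + 6) = h k
  j_period : ∀ k, j (k + 3) = j k
  p_period : ∀ k, p (k + 6) = p k
  q₁_period : ∀ k, q₁ (k + 6) = q₁ k
  q₂_period : ∀ k, q₂ (k + 6) = q₂ k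
  q₃_period : ∀ k, q₃ (k + 6) = q₃ k
  q₄_period : ∀ k, q₄ (k + 6) = q₄ k
  q₅_period : ∀ k, q₅ (k + 6) = q₅ k
  r_period : ∀ k, r (k + 6) = r k
  u_period : ∀ k, u (k + 3) = u k
  w_period : ∀ k, w (k + 6) = w k
  x_period : ∀ k, x (k + 3) = x k
  merge_q₄ : ∀ k, g k + h k + q₄ k = 0
  merge_p : ∀ k, g (k + 1) + p (k + 1) = 0
  merge_q₂ : ∀ k, g (k + 2) + h (k + 1) + q₂ (k + 3) = 0
  merge_q₁ : ∀ k, h (k + 2) + j (k + 1) + q₁ (k + 4) = 0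
  merge_q₅ : ∀ k, h (k + 5) + j (k + 2) + q₅ (k + 5) = 0
  merge_w : ∀ k, q₄ (k + 2) + q₅ (k + 1) + w (k + 3) = 0
  cap_g : ∀ k, n * g k + p k + q₃ k + q₄ k = 0
  cap_g' : ∀ k, n * g (k + 1) + p (k + 1) + q₂ (k + 2) + q₃ (k + 2) = 0
  cap_h : ∀ k, n * h (k + 1) + q₁ (k + 3) + q₂ (k + 3) + x (k + 1) = 0
  cap_h' : ∀ k, n * h (k + 5) + q₄ (k + 5) + q₅ (k + 5) + x (k + 2) = 0
  cap_j : ∀ k, n * j (k + 1) + q₁ (k + 4) + q₅ (k + 4) + b k = 0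
  cap_q₅ : ∀ k, n * q₅ (k + 1) + u (k + 2) + w (k + 3) = 0
  cap_q₂ : ∀ k, n * q₂ (k + 1) + r (k + 2) + w (k + 1) = 0
  cap_q₃ : ∀ k, n * q₃ (k + 1) + r (k + 3) + a k = 0

/-- Each relation is the fibre of merging or capping over one crossing word of length five, read off
by evaluation. Fourteen fibres suffice. -/
theorem crossingRelations {D : Family N} (hD : IsDual D) (hNC : homNC N ≤ D)
    (hX : wordMat N ![0, 1, 0, 1] ∉ D 0 4) (h4 : (N : ℂ) - 4 ≠ 0)
    (hq : (N : ℂ) ^ 2 - 3 * N + 1 ≠ 0) {c : List ℕ → ℂ}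
    (hc : ∑ w ∈ crossing6.toFinset, c w • listMat N 6 w ∈ D 0 6) {C : List ℕ → ℕ → ℂ}
    (hC : ∀ w k, c ((rotateList 5)^[k] w) = C w k) :
    CrossingRelations N (C [0, 1, 2, 1, 2, 5]) (C [0, 1, 2, 1, 4, 2]) (C [0, 1, 2, 3, 1, 2])
      (C [0, 1, 2, 1, 2, 0]) (C [0, 1, 2, 2, 1, 2]) (C [0, 1, 1, 3, 1, 3]) (C [0, 1, 2, 1, 2, 1])
      (C [0, 1, 2, 1, 2, 2]) (C [0, 1, 2, 1, 1, 2]) (C [0, 1, 1, 1, 0, 1]) (C [0, 1, 1, 0, 1, 1])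
      (C [0, 1, 1, 0, 1, 0]) (C [0, 1, 0, 1, 0, 1]) (C [0, 1, 2, 0, 1, 2])
      (C [0, 1, 2, 1, 0, 2]) := by
  have hL : crossing6.Nodup := by decide +kernel
  have hr : ∀ w ∈ crossing6.toFinset, rotateList 5 w ∈ crossing6.toFinset := by decide +kernel
  have hn : ∀ w ∈ crossing6.toFinset, (rotateList 5)^[6] w = w := by decide +kernel
  have hS := isSeparated_five hD hNC hX h4 hq
  have hm : ∀ w ∈ crossing6.toFinset, mergeList 4 w ∈ crossing5.toFinset ∨
      ¬ Crosses (letters 5 (mergeList 4 w)) := by decide +kernel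
  have hi : ∀ w ∈ crossing6.toFinset, initList 5 w ∈ crossing5.toFinset ∨
      ¬ Crosses (letters 5 (initList 5 w)) := by decide +kernel
  have merge := fun r hr' => IsSeparated.merge_equation hD hNC hS hL hr hn hm hc (r := r) hr'
  have cap := fun r hr' => IsSeparated.cap_equation hD hNC hS hL hr hn hi hc (r := r) hr'
  simp only [hC] at merge cap
  have period : ∀ m w, (rotateList 5)^[m] w = w → ∀ k, C w (k + m) = C w k := by
    intro m w hw k
    rw [← hC, ← hC, Function.iterate_add_apply, hw]
  refine ⟨period 6 _ (by decide +kernel), period 6 _ (by decide +kernel),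
    period 3 _ (by decide +kernel), period 6 _ (by decide +kernel),
    period 6 _ (by decide +kernel), period 6 _ (by decide +kernel),
    period 6 _ (by decide +kernel), period 6 _ (by decide +kernel),
    period 6 _ (by decide +kernel), period 6 _ (by decide +kernel),
    period 3 _ (by decide +kernel), period 6 _ (by decide +kernel),
    period 3 _ (by decide +kernel), ?_, ?_, ?_, ?_, ?_, ?_, ?_, ?_, ?_, ?_, ?_, ?_, ?_, ?_⟩
  · intro k
    simpa [add_assoc] using merge [0, 1, 2, 1, 2] (by decide +kernel)
      [([0, 1, 2, 1, 2, 5], 0), ([0, 1, 2, 1, 4, 2], 0), ([0, 1, 2, 1, 2, 2], 0)]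
      (by decide +kernel) k
  · intro k
    simpa [add_assoc] using merge [0, 1, 0, 1, 4] (by decide +kernel)
      [([0, 1, 2, 1, 2, 5], 1), ([0, 1, 2, 1, 2, 0], 1)] (by decide +kernel) k
  · intro k
    simpa [add_assoc] using merge [0, 1, 0, 3, 1] (by decide +kernel)
      [([0, 1, 2, 1, 2, 5], 2), ([0, 1, 2, 1, 4, 2], 1), ([0, 1, 1, 3, 1, 3], 3)]
      (by decide +kernel) k
  · intro k
    simpa [add_assoc] using merge [0, 1, 2, 0, 1] (by decide +kernel)
      [([0, 1, 2, 1, 4, 2], 2), ([0, 1, 2, 3, 1, 2], 1), ([0, 1, 2, 2, 1, 2], 4)]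
      (by decide +kernel) k
  · intro k
    simpa [add_assoc] using merge [0, 1, 2, 0, 2] (by decide +kernel)
      [([0, 1, 2, 1, 4, 2], 5), ([0, 1, 2, 3, 1, 2], 2), ([0, 1, 2, 1, 1, 2], 5)]
      (by decide +kernel) k
  · intro k
    simpa [add_assoc] using merge [0, 1, 0, 0, 1] (by decide +kernel)
      [([0, 1, 2, 1, 2, 2], 2), ([0, 1, 2, 1, 1, 2], 1), ([0, 1, 1, 0, 1, 0], 3)]
      (by decide +kernel) k
  · intro k
    simpa [add_assoc] using cap [0, 1, 2, 1, 2] (by decide +kernel)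
      [(true, [0, 1, 2, 1, 2, 5], 0), (false, [0, 1, 2, 1, 2, 0], 0),
        (false, [0, 1, 2, 1, 2, 1], 0), (false, [0, 1, 2, 1, 2, 2], 0)]
      (by decide +kernel) (by decide +kernel) k
  · intro k
    simpa [add_assoc] using cap [0, 1, 0, 1, 4] (by decide +kernel)
      [(true, [0, 1, 2, 1, 2, 5], 1), (false, [0, 1, 2, 1, 2, 0], 1),
        (false, [0, 1, 1, 3, 1, 3], 2), (false, [0, 1, 2, 1, 2, 1], 2)]
      (by decide +kernel) (by decide +kernel) k
  · intro k
    simpa [add_assoc] using cap [0, 1, 0, 3, 1] (by decide +kernel)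
      [(true, [0, 1, 2, 1, 4, 2], 1), (false, [0, 1, 2, 2, 1, 2], 3),
        (false, [0, 1, 1, 3, 1, 3], 3), (false, [0, 1, 2, 1, 0, 2], 1)]
      (by decide +kernel) (by decide +kernel) k
  · intro k
    simpa [add_assoc] using cap [0, 1, 2, 0, 2] (by decide +kernel)
      [(true, [0, 1, 2, 1, 4, 2], 5), (false, [0, 1, 2, 1, 2, 2], 5),
        (false, [0, 1, 2, 1, 1, 2], 5), (false, [0, 1, 2, 1, 0, 2], 2)]
      (by decide +kernel) (by decide +kernel) k
  · intro k
    simpa [add_assoc] using cap [0, 1, 2, 0, 1] (by decide +kernel)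
      [(true, [0, 1, 2, 3, 1, 2], 1), (false, [0, 1, 2, 2, 1, 2], 4),
        (false, [0, 1, 2, 1, 1, 2], 4), (false, [0, 1, 2, 0, 1, 2], 0)]
      (by decide +kernel) (by decide +kernel) k
  · intro k
    simpa [add_assoc] using cap [0, 1, 0, 0, 1] (by decide +kernel)
      [(true, [0, 1, 2, 1, 1, 2], 1), (false, [0, 1, 1, 0, 1, 1], 2),
        (false, [0, 1, 1, 0, 1, 0], 3)] (by decide +kernel) (by decide +kernel) k
  · intro k
    simpa [add_assoc] using cap [0, 0, 2, 0, 2] (by decide +kernel)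
      [(true, [0, 1, 1, 3, 1, 3], 1), (false, [0, 1, 1, 1, 0, 1], 2),
        (false, [0, 1, 1, 0, 1, 0], 1)] (by decide +kernel) (by decide +kernel) k
  · intro k
    simpa [add_assoc] using cap [0, 1, 0, 1, 0] (by decide +kernel)
      [(true, [0, 1, 2, 1, 2, 1], 1), (false, [0, 1, 1, 1, 0, 1], 3),
        (false, [0, 1, 0, 1, 0, 1], 0)] (by decide +kernel) (by decide +kernel) k

theorem mem_crossing6 {l : List ℕ} (hl : l ∈ allWords 6) (h : Crosses (letters 6 l)) :
    l ∈ crossing6 := by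
  revert l
  decide +kernel

theorem forall_of_two_three {F : ℕ → ℂ} (h2 : ∀ k, F (k + 2) = F k) (h3 : ∀ k, F (k + 3) = F k)
    (k : ℕ) : F k = F 0 := by
  induction k with
  | zero => rfl
  | succ k ih => rw [← h2, show k + 1 + 2 = k + 3 by ring, h3, ih]

/-- The solution of the relations, in terms of three values of `g` and two constants. -/
theorem CrossingRelations.solution {n : ℂ} {g h j p q₁ q₂ q₃ q₄ q₅ r u w a b x : ℕ → ℂ}
    (hR : CrossingRelations n g h j p q₁ q₂ q₃ q₄ q₅ r u w a b x) (hn : n - 2 ≠ 0) :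
    ∃ γ η : ℂ, (∀ k, g (k + 3) = g k) ∧ (∀ k, j k = γ + g (k + 1)) ∧
      (∀ k, h k = η - (n - 2) * g (k + 2)) ∧ (∀ k, p k = - g k) ∧
      (∀ k, q₁ k = -(γ + η + g (k + 1) - (n - 2) * g k)) ∧
      (∀ k, q₂ k = -(η + g (k + 2) - (n - 2) * g k)) ∧
      (∀ k, q₃ k = η - (n - 2) * (g k + g (k + 2))) ∧
      (∀ k, q₄ k = -(η + g k - (n - 2) * g (k + 2))) ∧
      (∀ k, q₅ k = -(γ + η + g (k + 1) - (n - 2) * g (k + 2))) ∧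
      (∀ k, r k = (n - 1) * η - (γ + η) + (n - 2) * (g k + g (k + 1)) -
        (n - 1) * (n - 2) * g (k + 2)) ∧
      (∀ k, u k = (n - 1) * (γ + η) - η + (n - 2) * (g k + g (k + 2)) -
        (n - 1) * (n - 2) * g (k + 1)) ∧
      (∀ k, w k = γ + η + η + 2 * g (k + 2) - (n - 2) * (g k + g (k + 1))) ∧
      (∀ k, a k = γ + η - (2 * n - 1) * η + (n - 1) * (n - 2) * (g 0 + g 1 + g 2)) ∧
      (∀ k, b k = 2 * η - (n - 2) * (γ + (g 0 + g 1 + g 2))) ∧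
      ∀ k, x k = g k + g (k + 1) + γ - (n - 2) * η + (n - 2) ^ 2 * g (k + 2) := by
  have eq₁ : ∀ k, q₁ k = -(h (k + 4) + j k) := by
    intro k
    have := hR.merge_q₁ (k + 2)
    simp only [add_assoc, Nat.reduceAdd, hR.q₁_period, hR.j_period] at this
    linear_combination this
  have eq₂ : ∀ k, q₂ k = -(g (k + 5) + h (k + 4)) := by
    intro k
    have := hR.merge_q₂ (k + 3)
    simp only [add_assoc, Nat.reduceAdd, hR.q₂_period] at this
    linear_combination this
  have eq₄ : ∀ k, q₄ k = -(g k + h k) := fun k => by linear_combination hR.merge_q₄ k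
  have eq₅ : ∀ k, q₅ k = -(h k + j k) := by
    intro k
    have := hR.merge_q₅ (k + 1)
    simp only [add_assoc, Nat.reduceAdd, hR.h_period, hR.q₅_period, hR.j_period] at this
    linear_combination this
  have ep : ∀ k, p k = - g k := by
    intro k
    have := hR.merge_p (k + 5)
    simp only [add_assoc, Nat.reduceAdd, hR.g_period, hR.p_period] at this
    linear_combination this
  have ex : ∀ k, x k = g k + j k - (n - 2) * h k := by
    intro k
    have := hR.cap_h' (k + 1)
    simp only [add_assoc, Nat.reduceAdd, hR.h_period, hR.q₄_period, hR.q₅_period, hR.x_period,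
      eq₄, eq₅] at this
    linear_combination this
  have ex' : ∀ k, x k = g (k + 1) + j (k + 2) - (n - 2) * h k := by
    intro k
    have h1 := hR.cap_h (k + 5)
    rw [show k + 5 + 1 = k + 6 by ring, show k + 5 + 3 = k + 2 + 6 by ring, hR.h_period,
      hR.q₁_period, hR.q₂_period, show k + 6 = k + 3 + 3 by ring, hR.x_period, hR.x_period,
      eq₁, eq₂] at h1
    rw [show k + 2 + 4 = k + 6 by ring, show k + 2 + 5 = k + 1 + 6 by ring, hR.h_period,
      hR.g_period] at h1
    linear_combination h1
  -- The two cap equations at `h` compute `x` in two ways.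
  have e1 : ∀ k, g (k + 1) + j (k + 2) = g k + j k := fun k => by
    linear_combination ex k - ex' k
  -- Over three consecutive indices the terms in `j`, of period 3, cancel.
  have hg : ∀ k, g (k + 3) = g k := by
    intro k
    have h1 := e1 k
    have h2 := e1 (k + 1)
    have h3 := e1 (k + 2)
    rw [show k + 1 + 2 = k + 3 by ring, hR.j_period] at h2
    rw [show k + 2 + 2 = k + 1 + 3 by ring, hR.j_period] at h3
    simp only [add_assoc, Nat.reduceAdd] at h1 h2 h3
    linear_combination h1 + h2 + h3
  have hh : ∀ k, h (k + 3) = h k := by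
    intro k
    have h1 := hR.x_period k
    rw [ex, ex, hg, hR.j_period] at h1
    refine mul_left_cancel₀ hn ?_
    linear_combination - h1
  have hg5 : ∀ k, g (k + 5) = g (k + 2) := fun k => hg (k + 2)
  have hh4 : ∀ k, h (k + 4) = h (k + 1) := fun k => hh (k + 1)
  have eq₃ : ∀ k, q₃ k = h k - (n - 2) * g k := fun k => by
    linear_combination hR.cap_g k - ep k - eq₄ k
  have eq₃' : ∀ k, q₃ (k + 2) = h k - (n - 2) * g (k + 1) := by
    intro k
    have h1 := hR.cap_g' k
    rw [ep, eq₂, show k + 2 + 5 = k + 1 + 6 by ring, show k + 2 + 4 = k + 6 by ring,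
      hR.g_period, hR.h_period] at h1
    linear_combination h1
  -- `j k - g (k + 1)` has periods 2 (by `e1` and `hg`) and 3, so it is a constant, later `γ`.
  have ej : ∀ k, j k = j 0 - g 1 + g (k + 1) := by
    intro k
    have := forall_of_two_three (F := fun k => j k - g (k + 1)) (fun k => ?_) (fun k => ?_) k
    · simp only [zero_add] at this
      linear_combination this
    · have h1 : g (k + 2 + 1) = g k := hg k
      linear_combination e1 k - h1
    · have h1 : g (k + 3 + 1) = g (k + 1) := hg (k + 1)
      linear_combination hR.j_period k - h1
  -- The two formulas for `q₃` give `h k + (n - 2) g (k + 2)` period 2. It also has period 3, and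
  -- its constant value becomes `η`.
  have eh : ∀ k, h k = h 0 + (n - 2) * g 2 - (n - 2) * g (k + 2) := by
    intro k
    have := forall_of_two_three (F := fun k => h k + (n - 2) * g (k + 2)) (fun k => ?_)
      (fun k => ?_) k
    · simp only [zero_add] at this
      linear_combination this
    · have h1 : g (k + 2 + 2) = g (k + 1) := hg (k + 1)
      linear_combination eq₃' k - eq₃ (k + 2) + (n - 2) * h1
    · have h1 : g (k + 3 + 2) = g (k + 2) := hg (k + 2)
      linear_combination hh k + (n - 2) * h1
  have sum3 : ∀ k, g k + g (k + 1) + g (k + 2) = g 0 + g 1 + g 2 := by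
    intro k
    induction k with
    | zero => simp only [zero_add]
    | succ k ih =>
      simp only [add_assoc, Nat.reduceAdd, hg] at ih ⊢
      linear_combination ih
  generalize j 0 - g 1 = γ at ej
  generalize h 0 + (n - 2) * g 2 = η at eh
  have fq₁ : ∀ k, q₁ k = -(γ + η + g (k + 1) - (n - 2) * g k) := by
    intro k
    rw [eq₁, hh4, eh, ej, show k + 1 + 2 = k + 3 by ring, hg]
    ring
  have fq₂ : ∀ k, q₂ k = -(η + g (k + 2) - (n - 2) * g k) := by
    intro k
    rw [eq₂, hh4, eh, hg5, show k + 1 + 2 = k + 3 by ring, hg]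
    ring
  have fq₃ : ∀ k, q₃ k = η - (n - 2) * (g k + g (k + 2)) := by
    intro k
    rw [eq₃, eh]
    ring
  have fq₅ : ∀ k, q₅ k = -(γ + η + g (k + 1) - (n - 2) * g (k + 2)) := by
    intro k
    rw [eq₅, eh, ej]
    ring
  have fq₄ : ∀ k, q₄ k = -(η + g k - (n - 2) * g (k + 2)) := by
    intro k
    rw [eq₄, eh]
    ring
  have fw : ∀ k, w k = γ + η + η + 2 * g (k + 2) - (n - 2) * (g k + g (k + 1)) := by
    intro k
    have h1 := hR.merge_w (k + 3)
    simp only [add_assoc, Nat.reduceAdd, hR.w_period, fq₄, fq₅, hg] at h1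
    linear_combination h1
  have fr : ∀ k, r k = (n - 1) * η - (γ + η) + (n - 2) * (g k + g (k + 1)) -
      (n - 1) * (n - 2) * g (k + 2) := by
    intro k
    have h1 := hR.cap_q₂ (k + 4)
    rw [show k + 4 + 2 = k + 6 by ring, hR.r_period, fq₂, fw] at h1
    simp only [add_assoc, Nat.reduceAdd, hg] at h1
    linear_combination h1
  refine ⟨γ, η, hg, ej, eh, ep, fq₁, fq₂, fq₃, fq₄, fq₅, fr, ?_, fw, ?_, ?_, ?_⟩
  · intro k
    have h1 := hR.cap_q₅ (k + 1)
    rw [show k + 1 + 2 = k + 3 by ring, hR.u_period, fq₅, fw] at h1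
    simp only [add_assoc, Nat.reduceAdd, hg] at h1
    linear_combination h1
  · intro k
    have h1 := hR.cap_q₃ k
    rw [fq₃, fr] at h1
    simp only [add_assoc, Nat.reduceAdd, hg] at h1
    linear_combination h1 + (n - 1) * (n - 2) * sum3 k
  · intro k
    have h1 := hR.cap_j k
    rw [fq₁, fq₅, ej] at h1
    simp only [add_assoc, Nat.reduceAdd, hg] at h1
    linear_combination h1 - (n - 2) * sum3 k
  · intro k
    rw [ex, ej, eh]
    ring

/-! ### Counting the nonzero coefficients of a solution -/

open Classical in
/-- The indicator of the nonzero numbers. -/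
noncomputable def nz (z : ℂ) : ℕ := if z = 0 then 0 else 1

theorem nz_zero : nz 0 = 0 := if_pos rfl

theorem nz_of_ne {z : ℂ} (h : z ≠ 0) : nz z = 1 := if_neg h

theorem nz_neg (z : ℂ) : nz (-z) = nz z := by simp [nz]

/-- Most of the lower bounds below come from this: two forms with nonzero difference do not vanish
together. -/
theorem one_le_nz_add_nz {u v : ℂ} (h : u - v ≠ 0) : 1 ≤ nz u + nz v := by
  by_cases hu : u = 0
  · rw [nz_of_ne (z := v)]
    · omega
    · rintro rfl
      exact h (by rw [hu, sub_zero])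
  · rw [nz_of_ne hu]
    omega

/-- The number of nonzero coefficients that depend on one value of `g` and the sum `s` of the
three values. -/
noncomputable def singleCount (n s γ η z : ℂ) : ℕ :=
  4 * nz z + 2 * nz (η - (n - 2) * z) + nz (γ + z) + 2 * nz (η - (n - 2) * (s - z)) +
    2 * nz ((n - 1) * η - (γ + η) + (n - 2) * (s - z) - (n - 1) * (n - 2) * z) +
    nz ((n - 1) * (γ + η) - η + (n - 2) * (s - z) - (n - 1) * (n - 2) * z) +
    2 * nz (γ + η + η + 2 * z - (n - 2) * (s - z)) +
    nz (s - z + γ - (n - 2) * η + (n - 2) ^ 2 * z)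

/-- One form for each ordered pair of distinct indices. Taken twice, `θ = η` covers `q₂` and `q₄`,
and `θ = γ + η` covers `q₁` and `q₅`. -/
noncomputable def pairCount (n θ y₀ y₁ y₂ : ℂ) : ℕ :=
  nz (θ + y₀ - (n - 2) * y₁) + nz (θ + y₁ - (n - 2) * y₂) + nz (θ + y₂ - (n - 2) * y₀) +
    nz (θ + y₁ - (n - 2) * y₀) + nz (θ + y₂ - (n - 2) * y₁) + nz (θ + y₀ - (n - 2) * y₂)

/-- The number of nonzero coefficients of a solution. -/
noncomputable def solutionCount (n s γ η y₀ y₁ y₂ : ℂ) : ℕ :=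
  singleCount n s γ η y₀ + singleCount n s γ η y₁ + singleCount n s γ η y₂ +
    2 * pairCount n η y₀ y₁ y₂ + 2 * pairCount n (γ + η) y₀ y₁ y₂ +
    nz (γ + η - (2 * n - 1) * η + (n - 1) * (n - 2) * s) + nz (2 * η - (n - 2) * (γ + s))

theorem solutionCount_swap₀ (n s γ η y₀ y₁ y₂ : ℂ) :
    solutionCount n s γ η y₀ y₁ y₂ = solutionCount n s γ η y₁ y₀ y₂ := by
  unfold solutionCount pairCount; ring

theorem solutionCount_swap₁ (n s γ η y₀ y₁ y₂ : ℂ) :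
    solutionCount n s γ η y₀ y₁ y₂ = solutionCount n s γ η y₀ y₂ y₁ := by
  unfold solutionCount pairCount; ring

section

variable {n s γ η : ℂ} (h0 : n ≠ 0) (h1 : n - 1 ≠ 0) (h2 : n - 2 ≠ 0) (h3 : n - 3 ≠ 0)

include h0 h1 h2 h3 in
-- For fixed `s`, each form is affine in `z` with nonzero slope, so it is nonzero at `z` or at `z'`.
-- The multiplicities add up to 15.
theorem le_singleCount_add_singleCount {z z' : ℂ} (h : z - z' ≠ 0) :
    15 ≤ singleCount n s γ η z + singleCount n s γ η z' := by
  have e1 := one_le_nz_add_nz h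
  have e2 : 1 ≤ nz (η - (n - 2) * z) + nz (η - (n - 2) * z') := by
    refine one_le_nz_add_nz ?_
    convert neg_ne_zero.2 (mul_ne_zero h2 h) using 1
    ring
  have e3 : 1 ≤ nz (γ + z) + nz (γ + z') := by
    refine one_le_nz_add_nz ?_
    convert h using 1
    ring
  have e4 : 1 ≤ nz (η - (n - 2) * (s - z)) + nz (η - (n - 2) * (s - z')) := by
    refine one_le_nz_add_nz ?_
    convert mul_ne_zero h2 h using 1
    ring
  have e5 := one_le_nz_add_nz
    (u := (n - 1) * η - (γ + η) + (n - 2) * (s - z) - (n - 1) * (n - 2) * z)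
    (v := (n - 1) * η - (γ + η) + (n - 2) * (s - z') - (n - 1) * (n - 2) * z') (by
      convert neg_ne_zero.2 (mul_ne_zero (mul_ne_zero h0 h2) h) using 1
      ring)
  have e6 := one_le_nz_add_nz
    (u := (n - 1) * (γ + η) - η + (n - 2) * (s - z) - (n - 1) * (n - 2) * z)
    (v := (n - 1) * (γ + η) - η + (n - 2) * (s - z') - (n - 1) * (n - 2) * z') (by
      convert neg_ne_zero.2 (mul_ne_zero (mul_ne_zero h0 h2) h) using 1
      ring)
  have e7 := one_le_nz_add_nz (u := γ + η + η + 2 * z - (n - 2) * (s - z))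
    (v := γ + η + η + 2 * z' - (n - 2) * (s - z')) (by
      convert mul_ne_zero h0 h using 1
      ring)
  have e8 := one_le_nz_add_nz (u := s - z + γ - (n - 2) * η + (n - 2) ^ 2 * z)
    (v := s - z' + γ - (n - 2) * η + (n - 2) ^ 2 * z') (by
      convert mul_ne_zero (mul_ne_zero h1 h3) h using 1
      ring)
  unfold singleCount
  omega

include h1 h2 in
-- The six ordered pairs split into two cyclic classes of three. A form of one class never vanishes
-- together with a form of the other, so one whole class is nonzero.
theorem le_pairCount_of_ne (θ : ℂ) {y₀ y₁ y₂ : ℂ} (h01 : y₀ - y₁ ≠ 0) (h12 : y₁ - y₂ ≠ 0)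
    (h20 : y₂ - y₀ ≠ 0) : 3 ≤ pairCount n θ y₀ y₁ y₂ := by
  have key : ∀ a b c : ℂ, a - b ≠ 0 → b - c ≠ 0 → c - a ≠ 0 →
      (1 ≤ nz (θ + a - (n - 2) * b) + nz (θ + b - (n - 2) * a)) ∧
      (1 ≤ nz (θ + a - (n - 2) * b) + nz (θ + c - (n - 2) * b)) ∧
      (1 ≤ nz (θ + a - (n - 2) * b) + nz (θ + a - (n - 2) * c)) := by
    intro a b c hab hbc hca
    refine ⟨one_le_nz_add_nz ?_, one_le_nz_add_nz ?_, one_le_nz_add_nz ?_⟩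
    · convert mul_ne_zero h1 hab using 1; ring
    · convert neg_ne_zero.2 hca using 1; ring
    · convert neg_ne_zero.2 (mul_ne_zero h2 hbc) using 1; ring
  obtain ⟨a1, a2, a3⟩ := key _ _ _ h01 h12 h20
  obtain ⟨b1, b2, b3⟩ := key _ _ _ h12 h20 h01
  obtain ⟨c1, c2, c3⟩ := key _ _ _ h20 h01 h12
  unfold pairCount
  omega

include h1 h2 in
-- The six forms are three forms taken twice, and at most one of the three vanishes.
theorem le_pairCount_of_eq (θ : ℂ) {y z : ℂ} (h : y - z ≠ 0) : 4 ≤ pairCount n θ y y z := by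
  have e1 := one_le_nz_add_nz (u := θ + y - (n - 2) * y) (v := θ + y - (n - 2) * z) (by
    convert neg_ne_zero.2 (mul_ne_zero h2 h) using 1; ring)
  have e2 := one_le_nz_add_nz (u := θ + y - (n - 2) * y) (v := θ + z - (n - 2) * y) (by
    convert h using 1; ring)
  have e3 := one_le_nz_add_nz (u := θ + y - (n - 2) * z) (v := θ + z - (n - 2) * y) (by
    convert mul_ne_zero h1 h using 1; ring)
  unfold pairCount
  omega

include h0 h1 h2 h3

theorem le_solutionCount_of_eq {y z : ℂ} (h : y - z ≠ 0) (hs : s = y + y + z) :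
    32 ≤ solutionCount n s γ η y y z := by
  have e1 := le_singleCount_add_singleCount (s := s) (γ := γ) (η := η) h0 h1 h2 h3 h
  have e2 := le_pairCount_of_eq h1 h2 η h
  have e3 := le_pairCount_of_eq h1 h2 (γ + η) h
  -- The other bounds give `15 + 2 * 4 + 2 * 4 = 31`; the missing unit comes from the second copy of
  -- `y`.
  have e4 : 1 ≤ singleCount n s γ η y := by
    by_contra hlt
    unfold singleCount at hlt
    have f : ∀ w, nz w = 0 → w = 0 := fun w hw => by_contra fun hw' => by
      rw [nz_of_ne hw'] at hw
      exact one_ne_zero hw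
    have f1 := f y (by omega)
    have f2 := f (η - (n - 2) * y) (by omega)
    have f3 := f (η - (n - 2) * (s - y)) (by omega)
    have f4 : (n - 2) * (y - z) = 0 := by
      rw [hs] at f3
      linear_combination f3 - f2 + (n - 2) * f1
    exact mul_ne_zero h2 h f4
  unfold solutionCount
  omega

/-- The three single counts add up to at least 45/2, hence 23, and the pair counts contribute 12. -/
theorem le_solutionCount_of_ne {y₀ y₁ y₂ : ℂ} (h01 : y₀ - y₁ ≠ 0) (h12 : y₁ - y₂ ≠ 0)
    (h20 : y₂ - y₀ ≠ 0) : 32 ≤ solutionCount n s γ η y₀ y₁ y₂ := by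
  have e1 := le_singleCount_add_singleCount (s := s) (γ := γ) (η := η) h0 h1 h2 h3 h01
  have e2 := le_singleCount_add_singleCount (s := s) (γ := γ) (η := η) h0 h1 h2 h3 h12
  have e3 := le_singleCount_add_singleCount (s := s) (γ := γ) (η := η) h0 h1 h2 h3 h20
  have e4 := le_pairCount_of_ne h1 h2 η h01 h12 h20
  have e5 := le_pairCount_of_ne h1 h2 (γ + η) h01 h12 h20
  unfold solutionCount
  omega

omit h3 in
theorem le_solutionCount_of_eq_eq {y : ℂ} (hs : s = y + y + y)
    (hne : ¬ (y = 0 ∧ γ = 0 ∧ η = 0)) : 32 ≤ solutionCount n s γ η y y y := by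
  -- With all three values equal to `y`, the pair forms all become `d` for `θ = η` and `e` for `θ =
  -- γ + η`, whence the terms `12 * nz d` and `12 * nz e`.
  obtain ⟨d, hd⟩ : ∃ d, d = η - (n - 3) * y := ⟨_, rfl⟩
  obtain ⟨e, he⟩ : ∃ e, e = γ + η - (n - 3) * y := ⟨_, rfl⟩
  have hη : η = d + (n - 3) * y := by linear_combination -hd
  have hγ : γ = e - d := by linear_combination hd - he
  have e1 : solutionCount n s γ η y y y = 12 * nz y + 6 * nz (d - y) + 3 * nz (e - d + y) +
      6 * nz (d - (n - 1) * y) + 6 * nz ((n - 1) * d - e) + 3 * nz ((n - 1) * e - d) +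
      6 * nz (d + e) + 3 * nz (e - (n - 1) * d + n * y) + 12 * nz d + 12 * nz e +
      nz (e - (2 * n - 1) * d + (n - 1) * n * y) + nz (2 * d - (n - 2) * (e - d) - n * y) := by
    have f0 : η + y - (n - 2) * y = d := by rw [hη]; ring
    have f1 : γ + η + y - (n - 2) * y = e := by rw [hη, hγ]; ring
    have f2 : η - (n - 2) * y = d - y := by rw [hη]; ring
    have f3 : γ + y = e - d + y := by rw [hγ]
    have f4 : η - (n - 2) * (s - y) = d - (n - 1) * y := by rw [hη, hs]; ring
    have f5 : (n - 1) * η - (γ + η) + (n - 2) * (s - y) - (n - 1) * (n - 2) * y =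
        (n - 1) * d - e := by rw [hη, hγ, hs]; ring
    have f6 : (n - 1) * (γ + η) - η + (n - 2) * (s - y) - (n - 1) * (n - 2) * y =
        (n - 1) * e - d := by rw [hη, hγ, hs]; ring
    have f7 : γ + η + η + 2 * y - (n - 2) * (s - y) = d + e := by rw [hη, hγ, hs]; ring
    have f8 : s - y + γ - (n - 2) * η + (n - 2) ^ 2 * y = e - (n - 1) * d + n * y := by
      rw [hη, hγ, hs]; ring
    have f9 : γ + η - (2 * n - 1) * η + (n - 1) * (n - 2) * s =
        e - (2 * n - 1) * d + (n - 1) * n * y := by rw [hη, hγ, hs]; ring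
    have f10 : 2 * η - (n - 2) * (γ + s) = 2 * d - (n - 2) * (e - d) - n * y := by
      rw [hη, hγ, hs]; ring
    unfold solutionCount pairCount singleCount
    rw [f0, f1, f2, f3, f4, f5, f6, f7, f8, f9, f10]
    ring
  rw [e1]
  by_cases hd0 : d = 0
  · by_cases he0 : e = 0
    -- Here the count is exactly 32, so the bound of the lemma is attained.
    · have hy : y ≠ 0 := by
        rintro rfl
        refine hne ⟨rfl, ?_, ?_⟩
        · rw [hγ, he0, hd0, sub_zero]
        · rw [hη, hd0, mul_zero, add_zero]
      simp only [hd0, he0, zero_sub, mul_zero, sub_zero, zero_add, nz_neg, nz_zero, add_zero]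
      rw [nz_of_ne hy, nz_of_ne (mul_ne_zero h1 hy), nz_of_ne (mul_ne_zero h0 hy),
        nz_of_ne (mul_ne_zero (mul_ne_zero h1 h0) hy)]
    · rw [hd0]
      simp only [zero_sub, mul_zero, sub_zero, zero_add, nz_neg, nz_zero, add_zero]
      rw [nz_of_ne he0, nz_of_ne (mul_ne_zero h1 he0)]
      by_cases hy : y = 0
      · simp only [hy, mul_zero, add_zero, nz_zero]
        rw [nz_of_ne he0]
        omega
      · rw [nz_of_ne hy]
        omega
  · by_cases he0 : e = 0
    · rw [he0]
      simp only [zero_sub, mul_zero, sub_zero, nz_neg, nz_zero, add_zero]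
      rw [nz_of_ne hd0, nz_of_ne (mul_ne_zero h1 hd0)]
      by_cases hy : y = 0
      · simp only [hy, mul_zero, add_zero, sub_zero, nz_zero]
        rw [nz_of_ne hd0]
        omega
      · rw [nz_of_ne hy]
        omega
    · rw [nz_of_ne hd0, nz_of_ne he0]
      -- At most one of three forms with weights 6, 3 and 6 vanishes, which adds at least 9 to the
      -- 24 from `d` and `e`.
      have a1 : 1 ≤ nz ((n - 1) * d - e) + nz (d + e) := by
        rw [← nz_neg (d + e)]
        refine one_le_nz_add_nz ?_
        convert mul_ne_zero h0 hd0 using 1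
        ring
      have a2 : 1 ≤ nz ((n - 1) * e - d) + nz (d + e) := by
        rw [← nz_neg (d + e)]
        refine one_le_nz_add_nz ?_
        convert mul_ne_zero h0 he0 using 1
        ring
      have a3 : 1 ≤ nz ((n - 1) * d - e) + nz ((n - 1) * e - d) := by
        by_contra hlt
        have f : ∀ w, nz w = 0 → w = 0 := fun w hw => by_contra fun hw' => by
          rw [nz_of_ne hw'] at hw
          exact one_ne_zero hw
        have f1 := f ((n - 1) * d - e) (by omega)
        have f2 := f ((n - 1) * e - d) (by omega)
        refine mul_ne_zero (mul_ne_zero h0 h2) hd0 ?_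
        linear_combination (n - 1) * f1 + f2
      omega

theorem le_solutionCount {y₀ y₁ y₂ : ℂ} (hs : s = y₀ + y₁ + y₂)
    (hne : ¬ (y₀ = 0 ∧ y₁ = 0 ∧ y₂ = 0 ∧ γ = 0 ∧ η = 0)) :
    32 ≤ solutionCount n s γ η y₀ y₁ y₂ := by
  by_cases h01 : y₀ = y₁
  · subst h01
    by_cases h12 : y₀ = y₂
    · subst h12
      exact le_solutionCount_of_eq_eq h0 h1 h2 hs fun h => hne ⟨h.1, h.1, h.1, h.2⟩
    · exact le_solutionCount_of_eq h0 h1 h2 h3 (sub_ne_zero.2 h12) hs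
  · by_cases h12 : y₁ = y₂
    · subst h12
      rw [solutionCount_swap₀, solutionCount_swap₁]
      exact le_solutionCount_of_eq h0 h1 h2 h3 (sub_ne_zero.2 (Ne.symm h01)) (by rw [hs]; ring)
    · by_cases h20 : y₂ = y₀
      · subst h20
        rw [solutionCount_swap₁]
        exact le_solutionCount_of_eq h0 h1 h2 h3 (sub_ne_zero.2 h01) (by rw [hs]; ring)
      · exact le_solutionCount_of_ne h0 h1 h2 h3 (sub_ne_zero.2 h01) (sub_ne_zero.2 h12)
          (sub_ne_zero.2 h20)

end

/-! ### Conclusion -/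

theorem sum_map_orbit (n k : ℕ) (w : List ℕ) (F : List ℕ → ℕ) :
    ((orbit n k w).map F).sum = ∑ i ∈ Finset.range k, F ((rotateList n)^[i] w) := by
  rw [orbit, List.map_map]
  rfl

/-- A vector with few coefficients none of whose images in `hom(0,4)` is crossing vanishes. -/
theorem eq_zero_of_card_le {D : Family N} (hD : IsDual D) (hNC : homNC N ≤ D)
    (hX : wordMat N ![0, 1, 0, 1] ∉ D 0 4) (hN : 6 ≤ N) {c : List ℕ → ℂ}
    (hc : ∑ w ∈ crossing6.toFinset, c w • listMat N 6 w ∈ D 0 6)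
    (hcard : (crossing6.toFinset.filter fun w => c w ≠ 0).card ≤ 31) :
    ∀ w ∈ crossing6, c w = 0 := by
  have hsub : ∀ m : ℕ, m < 6 → (N : ℂ) - m ≠ 0 := fun m hm h => by
    have : N = m := by exact_mod_cast sub_eq_zero.1 h
    omega
  have h0 : (N : ℂ) ≠ 0 := by simpa using hsub 0 (by norm_num)
  have h1 : (N : ℂ) - 1 ≠ 0 := by simpa using hsub 1 (by norm_num)
  have h2 : (N : ℂ) - 2 ≠ 0 := hsub 2 (by norm_num)
  have h3 : (N : ℂ) - 3 ≠ 0 := hsub 3 (by norm_num)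
  have h4 : (N : ℂ) - 4 ≠ 0 := hsub 4 (by norm_num)
  have hq : (N : ℂ) ^ 2 - 3 * N + 1 ≠ 0 := by
    intro h
    have h' : N ^ 2 + 1 = 3 * N := by
      have : (N : ℂ) ^ 2 + 1 = 3 * N := by linear_combination h
      exact_mod_cast this
    nlinarith
  have hcount : (crossing6.toFinset.filter fun w => c w ≠ 0).card =
      (crossing6.map fun w => nz (c w)).sum := by
    rw [← List.sum_toFinset _ (by decide +kernel : crossing6.Nodup), Finset.card_filter]
    refine Finset.sum_congr rfl fun w _ => ?_
    simp only [nz, ne_eq, ite_not]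
  obtain ⟨C, hC⟩ : ∃ C : List ℕ → ℕ → ℂ, ∀ w k, c ((rotateList 5)^[k] w) = C w k :=
    ⟨_, fun _ _ => rfl⟩
  obtain ⟨γ, η, hg, hj, hh, hp, hq₁, hq₂, hq₃, hq₄, hq₅, hr, hu, hw, ha, hb, hx⟩ :=
    (crossingRelations hD hNC hX h4 hq hc hC).solution h2
  have hg3 := hg 0
  have hg4 := hg 1
  have hg5 := hg 2
  have hg6 := hg 3
  have hg7 := hg 4
  norm_num at hg3 hg4 hg5 hg6 hg7
  rw [hg3] at hg6
  rw [hg4] at hg7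
  obtain ⟨y₀, hy₀⟩ : ∃ y, y = C [0, 1, 2, 1, 2, 5] 0 := ⟨_, rfl⟩
  obtain ⟨y₁, hy₁⟩ : ∃ y, y = C [0, 1, 2, 1, 2, 5] 1 := ⟨_, rfl⟩
  obtain ⟨y₂, hy₂⟩ : ∃ y, y = C [0, 1, 2, 1, 2, 5] 2 := ⟨_, rfl⟩
  -- The 71 coefficients, orbit by orbit, are up to sign the forms counted by `solutionCount`: three
  -- times 15, twice 12, and the two rotation-invariant words.
  have htotal : (crossing6.map fun w => nz (c w)).sum =
      solutionCount N (y₀ + y₁ + y₂) γ η y₀ y₁ y₂ := by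
    simp only [crossing6, List.map_append, List.sum_append, sum_map_orbit, hC,
      Finset.sum_range_succ, Finset.sum_range_zero, hj, hh, hp, hq₁, hq₂, hq₃, hq₄, hq₅, hr, hu,
      hw, ha, hb, hx, nz_neg, Nat.reduceAdd, hg3, hg4, hg5, hg6, hg7, ← hy₀, ← hy₁, ← hy₂]
    unfold solutionCount pairCount singleCount
    ring_nf
  have hz : y₀ = 0 ∧ y₁ = 0 ∧ y₂ = 0 ∧ γ = 0 ∧ η = 0 := by
    by_contra hne
    have := le_solutionCount h0 h1 h2 h3 rfl hne
    omega
  obtain ⟨hz₀, hz₁, hz₂, hγ, hη⟩ := hz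
  rw [htotal, hz₀, hz₁, hz₂, hγ, hη] at hcount
  simp only [solutionCount, pairCount, singleCount, mul_zero, add_zero, sub_zero, nz_zero,
    Finset.card_eq_zero, Finset.filter_eq_empty_iff, not_not, ne_eq, List.mem_toFinset] at hcount
  exact fun w hw => hcount hw

/-- A combination of `m` crossing partition vectors has at most `m` nonzero coefficients. -/
theorem combination_eq {m : ℕ} (α : Fin m → ℂ) {p : Fin m → Partition 0 6}
    (hp : ∀ i, (p i).IsCrossing) :
    ∃ c : List ℕ → ℂ, combination N α p = ∑ w ∈ crossing6.toFinset, c w • listMat N 6 w ∧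
      (crossing6.toFinset.filter fun w => c w ≠ 0).card ≤ m := by
  have h : ∀ i, ∃ l ∈ crossing6, partMat N (p i) = listMat N 6 l := by
    intro i
    obtain ⟨w, hw⟩ := exists_eq_wordPartition (p i)
    refine ⟨firstPlaces w, mem_crossing6 (firstPlaces_mem_allWords w) ?_, ?_⟩
    · rw [crosses_congr (letters_firstPlaces_eq_iff w), ← isCrossing_wordPartition_iff_crosses,
        ← hw]
      exact hp i
    · rw [listMat_firstPlaces, hw, wordMat]
  choose l hl hpl using h
  refine ⟨fun w => ∑ i with l i = w, α i, ?_, ?_⟩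
  · rw [combination, ← Finset.sum_fiberwise_of_maps_to (g := l) (t := crossing6.toFinset)
      fun i _ => List.mem_toFinset.2 (hl i)]
    refine Finset.sum_congr rfl fun w _ => ?_
    rw [Finset.sum_smul]
    refine Finset.sum_congr rfl fun i hi => ?_
    rw [hpl, (Finset.mem_filter.1 hi).2]
  · refine (Finset.card_le_card (t := Finset.univ.image l) fun w hw => ?_).trans
      (Finset.card_image_le.trans_eq (Finset.card_fin m))
    obtain ⟨i, hi, -⟩ := Finset.exists_ne_zero_of_sum_ne_zero (Finset.mem_filter.1 hw).2
    exact Finset.mem_image.2 ⟨i, Finset.mem_univ i, (Finset.mem_filter.1 hi).2⟩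

theorem generated_combination_eq_homP (hN : 6 ≤ N) {m : ℕ} (hm : m ≤ 31) (α : Fin m → ℂ)
    {p : Fin m → Partition 0 6} (hp : ∀ i, (p i).IsCrossing) (h : combination N α p ≠ 0) :
    generated (homNC N) (combination N α p) = homP N := by
  obtain ⟨⟨hD, hNC, hmem⟩, hmin⟩ := generated_isLeast (homNC N) (combination N α p)
  refine le_antisymm (hmin ⟨isDual_homP N, homNC_le_homP N, ?_⟩) ?_
  · exact Submodule.sum_mem _ fun i _ =>
      Submodule.smul_mem _ _ (Submodule.subset_span ⟨p i, rfl⟩)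
  · by_contra hle
    have hX : wordMat N ![0, 1, 0, 1] ∉ generated (homNC N) (combination N α p) 0 4 :=
      fun hX => hle (hD.homP_le hNC hX)
    obtain ⟨c, hc, hcard⟩ := combination_eq (N := N) α hp
    have hmem' : ∑ w ∈ crossing6.toFinset, c w • listMat N 6 w ∈
        generated (homNC N) (combination N α p) 0 6 := by
      rw [← hc]
      exact hmem
    have h0 := eq_zero_of_card_le hD hNC hX hN hmem' (hcard.trans hm)
    apply h
    rw [hc]
    exact Finset.sum_eq_zero fun w hw => by rw [h0 w (List.mem_toFinset.1 hw), zero_smul]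

end TannakaKrein

theorem theoremC :
    ∃ E : Finset ℕ, 6 ∉ E ∧ ∀ N : ℕ, 6 ≤ N → N ∉ E →
      TannakaKrein.IsMaximalAtEasinessMomentLevel N 31 6 ∧
      ∀ m : ℕ, m ≤ 31 → ∀ (α : Fin m → ℂ) (p : Fin m → TannakaKrein.Partition 0 6),
        (∀ i, (p i).IsCrossing) → TannakaKrein.combination N α p ≠ 0 →
          TannakaKrein.generated (TannakaKrein.homNC N) (TannakaKrein.combination N α p) =
            TannakaKrein.homP N :=
  -- No exceptions are needed. The bound `6 ≤ N` serves only to make `N`, `N - 1`, `N - 2`, `N - 3`,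
  -- `N - 4` and `N² - 3N + 1` nonzero.
  ⟨∅, Finset.notMem_empty 6, fun _ hN _ =>
    ⟨fun α _ hp h => Or.inl (TannakaKrein.generated_combination_eq_homP hN le_rfl α hp h),
      fun _ hm α _ hp h => TannakaKrein.generated_combination_eq_homP hN hm α hp h⟩⟩
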